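/- Let $C$ be a nonsingular projective curve over an algebraically closed field $k$, and let $s,t$ be natural numbers, $e,f$ integers, $r=s+t$ and $d=e+f$, with $ds-re=1$. A vector bundle $V$ on $C$ is called stable if it is nonzero and $\deg V'/\operatorname{rk}V'<\deg V/\operatorname{rk}V$ for every locally free subsheaf $V'\subset V$ with $0<\operatorname{rk}V'<\operatorname{rk}V$. Let $E$ be a stable vector bundle on $C$ of rank $s$ and degree $e$, and let $F$ be a stable vector bundle on $C$ of rank $t$ and degree $f$. Let $$0\longrightarrow E\longrightarrow G\longrightarrow F\longrightarrow 0$$ be a short exact sequence of $\mathcal O_C$-modules that does not split. Then $G$ is a stable vector bundle of rank $r$ and degree $d$. -/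

import Mathlib

open CategoryTheory AlgebraicGeometry TopologicalSpace

universe u

/-- A nonsingular projective curve over `k`: an integral scheme, proper over `Spec k`, of dimension
one, all of whose local rings are regular. (For curves over a field, proper and projective are
the same, and over an algebraically closed field nonsingular and smooth are the same.) -/
structure NonsingularProjectiveCurve (k : Type u) [Field k] where
  /-- The underlying scheme. -/
  X : Scheme.{u}
  /-- The structure morphism. -/
  toSpec : X ⟶ Spec (CommRingCat.of k)
  isIntegral : IsIntegral X
  isProper : IsProper toSpec
  dim_eq_one : topologicalKrullDim X = 1
  regular : ∀ x : X, IsRegularLocalRing (X.presheaf.stalk x)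

namespace NonsingularProjectiveCurve

variable {k : Type u} [Field k] (C : NonsingularProjectiveCurve k)

instance : IsIntegral C.X := C.isIntegral

instance : IsProper C.toSpec := C.isProper

instance : IsLocallyNoetherian C.X :=
  LocallyOfFiniteType.isLocallyNoetherian C.toSpec

end NonsingularProjectiveCurve

/-- A frame of rank `n` of an `𝒪_X`-module `M`: a nonempty open `U` and sections `s₁, …, sₙ` of `M`
over `U` such that `(c₁, …, cₙ) ↦ ∑ cᵢ sᵢ` is an isomorphism `𝒪_U ^ n ≅ M|_U`, that is, a bijection
on sections over every open `V ⊆ U`. -/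
structure SheafFrame {X : Scheme.{u}} (M : X.Modules) (n : ℕ) where
  /-- The domain of the frame. -/
  U : X.Opens
  nonempty : Nonempty U
  /-- The sections that form the frame. -/
  s : Fin n → Γ(M, U)
  bijective : ∀ (V : X.Opens) (hV : V ≤ U),
    Function.Bijective
      (fun c : Fin n → Γ(X, V) ↦ ∑ i, c i • M.presheaf.map (homOfLE hV).op (s i))

namespace SheafFrame

variable {X : Scheme.{u}} {M : X.Modules} {n : ℕ}

/-- The transition matrix `A` of two frames `s` and `s'` over the intersection of their domains,
characterized by `sᵢ = ∑ⱼ Aᵢⱼ s'ⱼ`. -/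
noncomputable def transitionMatrix (a b : SheafFrame M n) :
    Matrix (Fin n) (Fin n) Γ(X, a.U ⊓ b.U) :=
  fun i ↦ (Equiv.ofBijective _ (b.bijective (a.U ⊓ b.U) inf_le_right)).symm
    (M.presheaf.map (homOfLE (inf_le_left : a.U ⊓ b.U ≤ a.U)).op (a.s i))

theorem sum_transitionMatrix (a b : SheafFrame M n) (i : Fin n) :
    ∑ j, a.transitionMatrix b i j •
      M.presheaf.map (homOfLE (inf_le_right : a.U ⊓ b.U ≤ b.U)).op (b.s j) =
    M.presheaf.map (homOfLE (inf_le_left : a.U ⊓ b.U ≤ a.U)).op (a.s i) :=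
  (Equiv.ofBijective _ (b.bijective (a.U ⊓ b.U) inf_le_right)).apply_symm_apply _

theorem nonempty_inf [IrreducibleSpace X] (a b : SheafFrame M n) :
    Nonempty ((a.U ⊓ b.U : X.Opens)) := by
  obtain ⟨x, hx⟩ := nonempty_preirreducible_inter a.U.isOpen b.U.isOpen
    (Set.nonempty_coe_sort.mp a.nonempty) (Set.nonempty_coe_sort.mp b.nonempty)
  exact ⟨⟨x, hx⟩⟩

/-- The determinant of the transition matrix of two frames as a rational function; this is the
quotient `(s₁ ∧ ⋯ ∧ sₙ) / (s'₁ ∧ ⋯ ∧ s'ₙ)` of rational sections of `det M`. -/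
noncomputable def transitionDet [IrreducibleSpace X] (a b : SheafFrame M n) : X.functionField :=
  haveI := a.nonempty_inf b
  X.germToFunctionField (a.U ⊓ b.U) (a.transitionMatrix b).det

end SheafFrame

/-- A vector bundle on `X` (of constant rank): a locally free `𝒪_X`-module of finite rank. -/
structure AlgVectorBundle (X : Scheme.{u}) where
  /-- The sheaf of sections. -/
  sheaf : X.Modules
  /-- The rank. -/
  rank : ℕ
  exists_frame : ∀ x : X, ∃ a : SheafFrame sheaf rank, x ∈ a.U

namespace AlgVectorBundle

variable {X : Scheme.{u}}

/-- A frame of `E` around the point `x`. -/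
noncomputable def frameAt (E : AlgVectorBundle X) (x : X) : SheafFrame E.sheaf E.rank :=
  (E.exists_frame x).choose

theorem mem_frameAt (E : AlgVectorBundle X) (x : X) : x ∈ (E.frameAt x).U :=
  (E.exists_frame x).choose_spec

section Degree

variable [IsIntegral X] [IsLocallyNoetherian X]

/-- The divisor (as a function on points, zero off the points of codimension one) of the rational
section `s₁ ∧ ⋯ ∧ sₙ` of `det E` given by a frame of `E`: its value at `x` is the order of
vanishing at `x` of that section relative to a local generator of `det E` at `x`. -/
noncomputable def detDivisor (E : AlgVectorBundle X) (a : SheafFrame E.sheaf E.rank) (x : X) : ℤ :=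
  Scheme.ord (a.transitionDet (E.frameAt x)) x

/-- The degree of a vector bundle on a complete nonsingular curve over an algebraically closed
field: the degree of the line bundle `det E`, that is, of the divisor of a nonzero rational
section of `det E`. All points of codimension one have degree one here. -/
noncomputable def degree (E : AlgVectorBundle X) : ℤ :=
  ∑ᶠ x : X, E.detDivisor (E.frameAt (genericPoint X)) x

/-- The slope `μ(E) = deg E / rk E`. -/
noncomputable def slope (E : AlgVectorBundle X) : ℚ :=
  (E.degree : ℚ) / (E.rank : ℚ)

/-- Stability (Mumford): `E` is nonzero, and `μ(E') < μ(E)` for all locally free subsheaves `E'` of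
`E` with `0 < rk E' < rk E`. (On a nonsingular curve all coherent subsheaves of `E` are locally
free, and it is the same to ask this for the subbundles `E'` only.) -/
def IsStable (E : AlgVectorBundle X) : Prop :=
  0 < E.rank ∧ ∀ (E' : AlgVectorBundle X) (i : E'.sheaf ⟶ E.sheaf), Mono i →
    0 < E'.rank → E'.rank < E.rank → E'.slope < E.slope

end Degree

end AlgVectorBundle

/-- A family of discrete valuations of a field `K` over `k`, with all residue fields equal to `k`,
such that a nonzero element has only finitely many zeros and poles and only constants are regular
everywhere. -/
structure CompletePlaces (k K P : Type*) [Field k] [Field K] [Algebra k K] where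
  /-- The valuations. The value at zero is irrelevant. -/
  v : P → K → ℤ
  map_mul : ∀ p {f g}, f ≠ 0 → g ≠ 0 → v p (f * g) = v p f + v p g
  map_add : ∀ p {f g}, f ≠ 0 → g ≠ 0 → f + g ≠ 0 → min (v p f) (v p g) ≤ v p (f + g)
  finite_support : ∀ {f}, f ≠ 0 → {p | v p f ≠ 0}.Finite
  map_algebraMap : ∀ p {c : k}, c ≠ 0 → v p (algebraMap k K c) = 0
  residue : ∀ p {f}, f ≠ 0 → v p f = 0 →
    ∃ c : k, f = algebraMap k K c ∨ 0 < v p (f - algebraMap k K c)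
  uniformizer : ∀ p, ∃ π : K, π ≠ 0 ∧ v p π = 1
  incomparable : ∀ {p q}, p ≠ q → ∃ h : K, h ≠ 0 ∧ 0 ≤ v p h ∧ v q h < 0
  global : ∀ {f}, f ≠ 0 → (∀ p, 0 ≤ v p f) → ∃ c : k, f = algebraMap k K c

namespace CompletePlaces

variable {k K P : Type*} [Field k] [Field K] [Algebra k K] (S : CompletePlaces k K P)

theorem map_one (p : P) : S.v p 1 = 0 := by
  have := S.map_mul p (one_ne_zero (α := K)) one_ne_zero
  rw [mul_one] at this
  omega

theorem map_inv (p : P) {f : K} (hf : f ≠ 0) : S.v p f⁻¹ = -S.v p f := by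
  have := S.map_mul p hf (inv_ne_zero hf)
  rw [mul_inv_cancel₀ hf, map_one] at this
  omega

theorem map_div (p : P) {f g : K} (hf : f ≠ 0) (hg : g ≠ 0) :
    S.v p (f / g) = S.v p f - S.v p g := by
  rw [div_eq_mul_inv, S.map_mul p hf (inv_ne_zero hg), S.map_inv p hg, sub_eq_add_neg]

theorem map_pow (p : P) {f : K} (hf : f ≠ 0) (n : ℕ) : S.v p (f ^ n) = n * S.v p f := by
  induction n with
  | zero => simp [map_one]
  | succ n ih => rw [pow_succ, S.map_mul p (pow_ne_zero _ hf) hf, ih]; push_cast; ring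

theorem map_smul (p : P) {c : k} (hc : c ≠ 0) {f : K} (hf : f ≠ 0) :
    S.v p (c • f) = S.v p f := by
  rw [Algebra.smul_def, S.map_mul p (by simpa using hc) hf, S.map_algebraMap p hc, zero_add]

theorem map_neg (p : P) {f : K} (hf : f ≠ 0) : S.v p (-f) = S.v p f := by
  rw [← S.map_smul p (neg_ne_zero.mpr (one_ne_zero (α := k))) hf, neg_one_smul]

theorem map_add_of_lt (p : P) {f g : K} (hf : f ≠ 0) (hg : g ≠ 0) (h : S.v p f < S.v p g) :
    f + g ≠ 0 ∧ S.v p (f + g) = S.v p f := by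
  have h0 : f + g ≠ 0 := by
    intro h0
    rw [eq_neg_of_add_eq_zero_left h0, S.map_neg p hg] at h
    exact lt_irrefl _ h
  refine ⟨h0, le_antisymm ?_ ?_⟩
  · have h1 := S.map_add p h0 (neg_ne_zero.mpr hg) (by simpa using hf)
    rw [add_neg_cancel_right, S.map_neg p hg] at h1
    omega
  · have := S.map_add p hf hg h0
    omega

/-- The elements of order at least `n` at `p`. -/
def filtration (p : P) (n : ℤ) : Submodule k K where
  carrier := {f | f = 0 ∨ n ≤ S.v p f}
  zero_mem' := Or.inl rfl
  add_mem' := by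
    rintro f g hf hg
    by_cases hf0 : f = 0
    · simpa [hf0] using hg
    by_cases hg0 : g = 0
    · simpa [hg0] using hf
    by_cases h0 : f + g = 0
    · exact Or.inl h0
    have := S.map_add p hf0 hg0 h0
    have hf := hf.resolve_left hf0
    have hg := hg.resolve_left hg0
    exact Or.inr (by omega)
  smul_mem' := by
    rintro c f hf
    by_cases hc : c = 0
    · exact Or.inl (by simp [hc])
    by_cases hf0 : f = 0
    · exact Or.inl (by simp [hf0])
    exact Or.inr ((S.map_smul p hc hf0).symm ▸ hf.resolve_left hf0)

theorem mem_filtration {p : P} {n : ℤ} {f : K} :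
    f ∈ S.filtration p n ↔ f = 0 ∨ n ≤ S.v p f := Iff.rfl

open scoped Classical in
/-- The Riemann–Roch space of an effective divisor. -/
noncomputable def riemannRochSpace (D : Multiset P) : Submodule k K :=
  ⨅ p, S.filtration p (-(D.count p : ℤ))

open scoped Classical in
theorem mem_riemannRochSpace {D : Multiset P} {f : K} (hf : f ≠ 0) :
    f ∈ S.riemannRochSpace D ↔ ∀ p, -(D.count p : ℤ) ≤ S.v p f := by
  simp [riemannRochSpace, mem_filtration, hf]

theorem _root_.Submodule.finrank_le_succ_of_forall_sub_mem {k V : Type*} [Field k]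
    [AddCommGroup V] [Module k V] {A B : Submodule k V} [FiniteDimensional k A]
    (h : ∀ x ∈ B, x ∉ A → ∀ y ∈ B, ∃ c : k, y - c • x ∈ A) :
    FiniteDimensional k B ∧ Module.finrank k B ≤ Module.finrank k A + 1 := by
  by_cases hBA : B ≤ A
  · exact ⟨Submodule.finiteDimensional_of_le hBA, (Submodule.finrank_mono hBA).trans (by omega)⟩
  obtain ⟨x, hxB, hxA⟩ := Set.not_subset.mp hBA
  have hle : B ≤ A ⊔ k ∙ x := by
    intro y hy
    obtain ⟨c, hc⟩ := h x hxB hxA y hy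
    exact Submodule.mem_sup.mpr ⟨_, hc, c • x, Submodule.mem_span_singleton.mpr ⟨c, rfl⟩, by simp⟩
  refine ⟨Submodule.finiteDimensional_of_le hle, (Submodule.finrank_mono hle).trans ?_⟩
  refine (Submodule.finrank_add_le_finrank_add_finrank _ _).trans ?_
  have := finrank_span_le_card (R := k) ({x} : Set V)
  simp only [Set.toFinset_singleton, Finset.card_singleton] at this
  omega

open scoped Classical in
theorem finrank_riemannRochSpace_le (D : Multiset P) :
    FiniteDimensional k (S.riemannRochSpace D) ∧
      Module.finrank k (S.riemannRochSpace D) ≤ D.card + 1 := by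
  induction D using Multiset.induction with
  | empty =>
    have hle : S.riemannRochSpace 0 ≤ k ∙ (1 : K) := by
      intro f hf
      by_cases hf0 : f = 0
      · simp [hf0]
      obtain ⟨c, rfl⟩ := S.global hf0 (by simpa using (S.mem_riemannRochSpace hf0).mp hf)
      exact Submodule.mem_span_singleton.mpr ⟨c, by simp [Algebra.smul_def]⟩
    refine ⟨Submodule.finiteDimensional_of_le hle, (Submodule.finrank_mono hle).trans ?_⟩
    have := finrank_span_le_card (R := k) ({1} : Set K)
    simpa using this
  | cons p D ih =>
    have := ih.1
    suffices h : ∀ x ∈ S.riemannRochSpace (p ::ₘ D), x ∉ S.riemannRochSpace D →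
        ∀ y ∈ S.riemannRochSpace (p ::ₘ D), ∃ c : k, y - c • x ∈ S.riemannRochSpace D by
      obtain ⟨h1, h2⟩ := Submodule.finrank_le_succ_of_forall_sub_mem h
      refine ⟨h1, h2.trans ?_⟩
      rw [Multiset.card_cons]
      omega
    intro x hx hxD y hy
    by_cases hyD : y ∈ S.riemannRochSpace D
    · exact ⟨0, by simpa using hyD⟩
    have key : ∀ z ∈ S.riemannRochSpace (p ::ₘ D), z ∉ S.riemannRochSpace D →
        z ≠ 0 ∧ S.v p z = -(D.count p : ℤ) - 1 := by
      intro z hz hzD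
      have hz0 : z ≠ 0 := by rintro rfl; exact hzD (zero_mem _)
      rw [S.mem_riemannRochSpace hz0] at hz hzD
      push Not at hzD
      obtain ⟨q, hq⟩ := hzD
      have hzq := hz q
      have hzp := hz p
      by_cases hqp : q = p
      · subst hqp
        rw [Multiset.count_cons_self] at hzq
        push_cast at hzq
        exact ⟨hz0, by omega⟩
      · rw [Multiset.count_cons_of_ne hqp] at hzq
        omega
    obtain ⟨hx0, hxv⟩ := key x hx hxD
    obtain ⟨hy0, hyv⟩ := key y hy hyD
    obtain ⟨c, hc⟩ := S.residue p (div_ne_zero hy0 hx0)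
      (by rw [S.map_div p hy0 hx0, hxv, hyv, sub_self])
    refine ⟨c, ?_⟩
    have hmem : y - c • x ∈ S.riemannRochSpace (p ::ₘ D) := sub_mem hy (Submodule.smul_mem _ _ hx)
    by_cases h0 : y - c • x = 0
    · simp [h0]
    by_contra hcon
    have hv := (key _ hmem hcon).2
    have heq : y - c • x = x * (y / x - algebraMap k K c) := by
      rw [Algebra.smul_def, mul_sub, mul_div_cancel₀ _ hx0]; ring
    have h1 : y / x - algebraMap k K c ≠ 0 := by
      intro h1; rw [heq, h1, mul_zero] at h0; exact h0 rfl
    rw [heq, S.map_mul p hx0 h1, hxv] at hv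
    have := hc.resolve_left (sub_ne_zero.mp h1)
    omega

theorem exists_neg_of_notMem (T : Finset P) {p : P} (hp : p ∉ T) :
    ∃ a : K, a ≠ 0 ∧ S.v p a < 0 ∧ ∀ q ∈ T, 0 < S.v q a := by
  classical
  induction T using Finset.induction with
  | empty =>
    obtain ⟨π, h0, hπ⟩ := S.uniformizer p
    exact ⟨π⁻¹, inv_ne_zero h0, by rw [S.map_inv p h0]; omega, by simp⟩
  | insert r T hr ih =>
    have hpr : p ≠ r := by rintro rfl; exact hp (Finset.mem_insert_self _ _)
    obtain ⟨a, ha0, hap, haT⟩ := ih (fun h ↦ hp (Finset.mem_insert_of_mem h))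
    obtain ⟨h, hh0, hhp, hhr⟩ := S.incomparable hpr
    obtain ⟨g, hg0, hgr, hgp⟩ := S.incomparable hpr.symm
    have hb0 : g / h ≠ 0 := div_ne_zero hg0 hh0
    have hbp : S.v p (g / h) < 0 := by rw [S.map_div p hg0 hh0]; omega
    have hbr : 0 < S.v r (g / h) := by rw [S.map_div r hg0 hh0]; omega
    set b := g / h
    obtain ⟨N, hN⟩ : ∃ N : ℕ, ∀ q ∈ T, -S.v q b < N := by
      refine ⟨∑ q ∈ T, ((-S.v q b).toNat + 1), fun q hq ↦ ?_⟩
      have := Finset.single_le_sum (f := fun q ↦ ((-S.v q b).toNat + 1)) (fun _ _ ↦ Nat.zero_le _) hq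
      omega
    have haN0 : a ^ (N + 1) ≠ 0 := pow_ne_zero _ ha0
    have hpow : ∀ q, S.v q (a ^ (N + 1)) = (N + 1 : ℤ) * S.v q a := fun q ↦ by
      rw [S.map_pow q ha0]; push_cast; rfl
    have hT : ∀ q ∈ T, 0 < (N + 1 : ℤ) * S.v q a + S.v q b := fun q hq ↦ by
      have h1 := haT q hq
      have h2 := hN q hq
      nlinarith
    have hp1 : (N + 1 : ℤ) * S.v p a < 0 := by nlinarith
    rcases lt_trichotomy (S.v r a) 0 with hra | hra | hra
    · have h1 := fun q (hq : 0 < S.v q (a ^ (N + 1))) ↦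
        S.map_add_of_lt q one_ne_zero haN0 (by rwa [S.map_one])
      have h2 := fun q (hq : S.v q (a ^ (N + 1)) < 0) ↦
        S.map_add_of_lt q haN0 one_ne_zero (by rwa [S.map_one])
      have hr1 : (N + 1 : ℤ) * S.v r a < 0 := by nlinarith
      obtain ⟨hs0, hsp⟩ := h2 p (by rwa [hpow])
      rw [add_comm] at hs0 hsp
      have hsr := (h2 r (by rwa [hpow])).2
      rw [add_comm] at hsr
      refine ⟨a ^ (N + 1) / (1 + a ^ (N + 1)) * b, mul_ne_zero (div_ne_zero haN0 hs0) hb0, ?_, ?_⟩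
      · rw [S.map_mul p (div_ne_zero haN0 hs0) hb0, S.map_div p haN0 hs0, hsp]
        omega
      · intro q hq
        rw [S.map_mul q (div_ne_zero haN0 hs0) hb0, S.map_div q haN0 hs0]
        rcases Finset.mem_insert.mp hq with rfl | hq
        · rw [hsr]; omega
        · have hpos : 0 < (N + 1 : ℤ) * S.v q a := by have := haT q hq; positivity
          rw [(h1 q (by rwa [hpow])).2, S.map_one, hpow]
          have := hT q hq
          omega
    · refine ⟨a ^ (N + 1) * b, mul_ne_zero haN0 hb0, ?_, ?_⟩
      · rw [S.map_mul p haN0 hb0, hpow]; omega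
      · intro q hq
        rw [S.map_mul q haN0 hb0, hpow]
        rcases Finset.mem_insert.mp hq with rfl | hq
        · rw [hra]; omega
        · exact hT q hq
    · refine ⟨a, ha0, hap, fun q hq ↦ ?_⟩
      rcases Finset.mem_insert.mp hq with rfl | hq
      · exact hra
      · exact haT q hq

/-- Weak approximation. -/
theorem exists_eq_of_forall_le (T : Finset P) {p : P} (hp : p ∉ T) (j : ℕ) (n : P → ℤ) :
    ∃ e : K, e ≠ 0 ∧ S.v p e = j ∧ ∀ q ∈ T, n q ≤ S.v q e := by
  obtain ⟨a, ha0, hap, haT⟩ := S.exists_neg_of_notMem T hp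
  obtain ⟨π, hπ0, hπ⟩ := S.uniformizer p
  obtain ⟨N, hN⟩ : ∃ N : ℕ, ∀ q ∈ T, n q - S.v q (π ^ j) ≤ N := by
    refine ⟨∑ q ∈ T, (n q - S.v q (π ^ j)).toNat, fun q hq ↦ ?_⟩
    have := Finset.single_le_sum (f := fun q ↦ (n q - S.v q (π ^ j)).toNat)
      (fun _ _ ↦ Nat.zero_le _) hq
    omega
  have haN0 : a ^ (N + 1) ≠ 0 := pow_ne_zero _ ha0
  have hπj : π ^ j ≠ 0 := pow_ne_zero _ hπ0
  have hpow : ∀ q, S.v q (a ^ (N + 1)) = (N + 1 : ℤ) * S.v q a := fun q ↦ by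
    rw [S.map_pow q ha0]; push_cast; rfl
  obtain ⟨hs0, hsp⟩ := S.map_add_of_lt p haN0 one_ne_zero
    (by rw [S.map_one, hpow]; nlinarith)
  refine ⟨a ^ (N + 1) / (a ^ (N + 1) + 1) * π ^ j, mul_ne_zero (div_ne_zero haN0 hs0) hπj, ?_, ?_⟩
  · rw [S.map_mul p (div_ne_zero haN0 hs0) hπj, S.map_div p haN0 hs0, hsp, S.map_pow p hπ0, hπ]
    ring
  · intro q hq
    have h1 := haT q hq
    have h2 := (S.map_add_of_lt q one_ne_zero haN0
      (by rw [S.map_one, hpow]; positivity)).2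
    rw [add_comm] at h2
    rw [S.map_mul q (div_ne_zero haN0 hs0) hπj, S.map_div q haN0 hs0, h2, S.map_one, hpow]
    have := hN q hq
    nlinarith

open scoped Classical in
/-- The divisor of poles. -/
noncomputable def poles (f : K) : Multiset P :=
  if hf : f ≠ 0 then
    ∑ p ∈ (S.finite_support hf).toFinset, Multiset.replicate (-S.v p f).toNat p
  else 0

open scoped Classical in
theorem count_poles {f : K} (hf : f ≠ 0) (p : P) : (S.poles f).count p = (-S.v p f).toNat := by
  rw [poles, dif_pos hf, Multiset.count_sum']
  simp only [Multiset.count_replicate]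
  rw [Finset.sum_ite_eq']
  split_ifs with h
  · rfl
  · simp only [Set.Finite.mem_toFinset, Set.mem_ofPred_eq, not_not] at h
    simp [h]

theorem card_poles {f : K} (hf : f ≠ 0) :
    (S.poles f).card = ∑ p ∈ (S.finite_support hf).toFinset, (-S.v p f).toNat := by
  rw [poles, dif_pos hf, Multiset.card_sum]
  simp

theorem sum_ne_zero_of_unique_min {ι : Type*} (s : Finset ι) (p : P) (y : ι → K) {i₀ : ι}
    (hi₀ : i₀ ∈ s) (hy : y i₀ ≠ 0)
    (h : ∀ i ∈ s, i ≠ i₀ → y i ∈ S.filtration p (S.v p (y i₀) + 1)) : ∑ i ∈ s, y i ≠ 0 := by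
  classical
  intro h0
  rw [← Finset.add_sum_erase s y hi₀] at h0
  have hmem : -∑ i ∈ s.erase i₀, y i ∈ S.filtration p (S.v p (y i₀) + 1) :=
    neg_mem (sum_mem fun i hi ↦ h i (Finset.mem_of_mem_erase hi) (Finset.ne_of_mem_erase hi))
  rw [← eq_neg_of_add_eq_zero_left h0, mem_filtration] at hmem
  have := hmem.resolve_left hy
  omega

theorem card_poles_inv_le {f : K} (hf : f ≠ 0) : (S.poles f⁻¹).card ≤ (S.poles f).card := by
  classical
  set T : Finset P := (S.finite_support (inv_ne_zero hf)).toFinset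
  set e : P → ℕ := fun p ↦ (-S.v p f⁻¹).toNat with he
  have he' : ∀ p, 0 < e p → S.v p f = e p := fun p hp ↦ by
    simp only [he, S.map_inv p hf, neg_neg] at hp ⊢; omega
  let ι := Σ p : T, Fin (e p)
  have hu : ∀ i : ι, ∃ x : K, x ≠ 0 ∧ S.v i.1 x = (i.2 : ℕ) ∧
      ∀ q ∈ T.erase i.1, (e q : ℤ) ≤ S.v q x := fun i ↦
    S.exists_eq_of_forall_le _ (Finset.notMem_erase _ _) _ _
  choose x hx0 hxv hxq using hu
  have hcard : Fintype.card ι = (S.poles f⁻¹).card := by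
    rw [S.card_poles (inv_ne_zero hf), Fintype.card_sigma]
    simp only [Fintype.card_fin]
    exact Finset.sum_coe_sort T e
  set C : Multiset P := ∑ i, S.poles (x i)
  have hbound : ∀ M : ℕ, (M + 1) * (S.poles f⁻¹).card ≤ C.card + M * (S.poles f).card + 1 := by
    intro M
    let y : ι × Fin (M + 1) → K := fun i ↦ x i.1 * f ^ (i.2 : ℕ)
    have hy0 : ∀ i, y i ≠ 0 := fun i ↦ mul_ne_zero (hx0 _) (pow_ne_zero _ hf)
    have hyv : ∀ i p, S.v p (y i) = S.v p (x i.1) + (i.2 : ℕ) * S.v p f := fun i p ↦ by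
      rw [S.map_mul p (hx0 _) (pow_ne_zero _ hf), S.map_pow p hf]
    have hmem : ∀ i, y i ∈ S.riemannRochSpace (C + M • S.poles f) := by
      intro i
      rw [S.mem_riemannRochSpace (hy0 i)]
      intro p
      rw [hyv, Multiset.count_add, Multiset.count_nsmul, S.count_poles hf, Multiset.count_sum']
      have h1 := Finset.single_le_sum (f := fun j ↦ (S.poles (x j)).count p)
        (fun _ _ ↦ Nat.zero_le _) (Finset.mem_univ i.1)
      simp only [S.count_poles (hx0 _)] at h1 ⊢
      have h2 : (i.2 : ℕ) ≤ M := Nat.lt_succ_iff.mp i.2.2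
      have h3 : -((M : ℤ) * (-S.v p f).toNat) ≤ (i.2 : ℕ) * S.v p f := by
        rcases le_total 0 (S.v p f) with h | h
        · have : 0 ≤ ((i.2 : ℕ) : ℤ) * S.v p f := by positivity
          have : (0 : ℤ) ≤ M * (-S.v p f).toNat := by positivity
          omega
        · have h4 : ((-S.v p f).toNat : ℤ) = -S.v p f := by omega
          rw [h4]
          have : ((i.2 : ℕ) : ℤ) ≤ M := by exact_mod_cast h2
          nlinarith
      push_cast
      have h5 := Int.self_le_toNat (-S.v p (x i.1))
      have h6 : (((-S.v p (x i.1)).toNat : ℕ) : ℤ) ≤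
        ((∑ j, (-S.v p (x j)).toNat : ℕ) : ℤ) := by exact_mod_cast h1
      push_cast at h6
      omega
    have hli : LinearIndependent k y := by
      rw [Fintype.linearIndependent_iff]
      intro g hg
      by_contra hne
      push Not at hne
      obtain ⟨i₁, hi₁⟩ := hne
      obtain ⟨i₀, hi₀, hmin⟩ := Finset.exists_min_image (Finset.univ.filter fun i ↦ g i ≠ 0)
        (fun i ↦ toLex ((i.2 : ℕ), ((i.1.2 : Fin _) : ℕ))) ⟨i₁, by simpa using hi₁⟩
      have hg0 : g i₀ ≠ 0 := by simpa using hi₀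
      have hep : 0 < e i₀.1.1 := i₀.1.2.pos
      refine S.sum_ne_zero_of_unique_min Finset.univ i₀.1.1 (fun i ↦ g i • y i)
        (Finset.mem_univ i₀) (smul_ne_zero hg0 (hy0 _)) ?_ hg
      intro i _ hi
      by_cases hgi : g i = 0
      · simp [hgi]
      refine Or.inr ?_
      rw [S.map_smul _ hgi (hy0 _), S.map_smul _ hg0 (hy0 _), hyv, hyv, hxv, he' _ hep]
      have hlex := hmin i (by simpa using hgi)
      rw [Prod.Lex.le_iff] at hlex
      simp only [ofLex_toLex] at hlex
      have hj0 : ((i₀.1.2 : ℕ) : ℤ) + 1 ≤ e i₀.1.1 := by exact_mod_cast i₀.1.2.2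
      by_cases hip : i.1.1 = i₀.1.1
      · have hiv : S.v i₀.1.1 (x i.1) = (i.1.2 : ℕ) := by rw [← hip]; exact hxv i.1
        rw [hiv]
        rcases hlex with h | ⟨h, h'⟩
        · have : ((i₀.2 : ℕ) : ℤ) + 1 ≤ (i.2 : ℕ) := by exact_mod_cast h
          nlinarith [Int.natCast_nonneg (i.1.2 : ℕ)]
        · rcases h'.lt_or_eq with h' | h'
          · rw [h]
            have : ((i₀.1.2 : ℕ) : ℤ) + 1 ≤ (i.1.2 : ℕ) := by exact_mod_cast h'
            omega
          · exfalso
            apply hi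
            obtain ⟨⟨p, j⟩, l⟩ := i
            obtain ⟨⟨p₀, j₀⟩, l₀⟩ := i₀
            obtain rfl : p = p₀ := hip
            obtain rfl : j = j₀ := Fin.ext h'.symm
            obtain rfl : l = l₀ := Fin.ext h.symm
            rfl
      · have h1 := hxq i.1 i₀.1.1 (Finset.mem_erase.mpr
          ⟨fun h ↦ hip (Subtype.ext h.symm), i₀.1.1.2⟩)
        have h2 : ((i₀.2 : ℕ) : ℤ) ≤ (i.2 : ℕ) := by
          rcases hlex with h | ⟨h, -⟩
          · exact_mod_cast h.le
          · exact_mod_cast h.le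
        nlinarith
    obtain ⟨hfd, hle⟩ := S.finrank_riemannRochSpace_le (C + M • S.poles f)
    have hli' : LinearIndependent k
        (fun i ↦ (⟨y i, hmem i⟩ : S.riemannRochSpace (C + M • S.poles f))) :=
      LinearIndependent.of_comp (Submodule.subtype _) hli
    have h1 := hli'.fintype_card_le_finrank
    rw [Fintype.card_prod, Fintype.card_fin, hcard] at h1
    rw [Multiset.card_add, Multiset.card_nsmul] at hle
    rw [mul_comm]
    exact h1.trans hle
  by_contra hlt
  push Not at hlt
  have h := hbound (C.card + 1)
  nlinarith

theorem finsum_eq_zero {f : K} (hf : f ≠ 0) : ∑ᶠ p, S.v p f = 0 := by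
  have h : (S.poles f⁻¹).card = (S.poles f).card := by
    refine le_antisymm (S.card_poles_inv_le hf) ?_
    have := S.card_poles_inv_le (inv_ne_zero hf)
    rwa [inv_inv] at this
  rw [S.card_poles hf, S.card_poles (inv_ne_zero hf)] at h
  have hT : (S.finite_support (inv_ne_zero hf)).toFinset = (S.finite_support hf).toFinset := by
    ext p; simp [S.map_inv p hf]
  rw [hT] at h
  rw [finsum_eq_sum_of_support_subset (s := (S.finite_support hf).toFinset) _ (by
    intro p hp; simpa using hp)]
  have h' : ((∑ p ∈ (S.finite_support hf).toFinset, (-S.v p f⁻¹).toNat : ℕ) : ℤ) =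
    ((∑ p ∈ (S.finite_support hf).toFinset, (-S.v p f).toNat : ℕ) : ℤ) := by exact_mod_cast h
  push_cast at h'
  rw [← sub_eq_zero, ← Finset.sum_sub_distrib] at h'
  refine Eq.trans ?_ h'
  refine Finset.sum_congr rfl fun p _ ↦ ?_
  rw [S.map_inv p hf]
  omega

end CompletePlaces

namespace NonsingularProjectiveCurve

variable {k : Type u} [Field k] (C : NonsingularProjectiveCurve k)

theorem coheight_le_one (x : C.X) : Order.coheight x ≤ 1 := by
  have h1 : Order.krullDim C.X = 1 := by
    rw [← C.dim_eq_one, topologicalKrullDim,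
      Order.krullDim_eq_of_orderIso (irreducibleSetEquivPoints (α := C.X))]
  have h := Order.coheight_le_krullDim x
  rw [h1] at h
  exact_mod_cast h

theorem coheight_eq_one_iff {x : C.X} : Order.coheight x = 1 ↔ x ≠ genericPoint C.X := by
  have h0 : Order.coheight x = 0 ↔ x = genericPoint C.X := by
    rw [Order.coheight_eq_zero]
    constructor
    · intro h
      exact (show genericPoint C.X ⤳ x from genericPoint_specializes x).antisymm
        (h (genericPoint_specializes x)) |>.eq.symm
    · rintro rfl
      intro y _
      exact genericPoint_specializes y
  rw [ne_eq, ← h0]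
  have := C.coheight_le_one x
  constructor
  · intro h; rw [h]; exact one_ne_zero
  · intro h
    exact le_antisymm this (Order.one_le_iff_ne_zero.mpr h)

theorem isClosed_singleton {x : C.X} (hx : Order.coheight x = 1) : IsClosed {x} := by
  rw [← closure_eq_iff_isClosed]
  refine Set.Subset.antisymm ?_ subset_closure
  intro y hy
  have hxy : x ⤳ y := specializes_iff_mem_closure.mpr hy
  by_contra hne
  have hlt : y < x := lt_of_le_not_ge hxy fun hyx ↦ hne (Specializes.antisymm hyx hxy).eq
  have h := Order.coheight_add_one_le hlt
  have := h.trans (C.coheight_le_one y)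
  rw [hx] at this
  exact absurd this (by decide)

instance : CompactSpace C.X :=
  (quasiCompact_iff_compactSpace C.toSpec).mp inferInstance

instance : IsNoetherian C.X where

theorem finite_of_isClosed {Z : Set C.X} (hZ : IsClosed Z) (hη : genericPoint C.X ∉ Z) :
    Z.Finite := by
  obtain ⟨S, hS, hcl, hirr, rfl⟩ := NoetherianSpace.exists_finite_set_isClosed_irreducible hZ
  refine hS.sUnion fun t ht ↦ ?_
  obtain ⟨z, hz⟩ := QuasiSober.sober (hirr t ht) (hcl t ht)
  have hzt : z ∈ t := hz.mem
  have hz1 : Order.coheight z = 1 := C.coheight_eq_one_iff.mpr (by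
    rintro rfl
    exact hη ⟨t, ht, hzt⟩)
  rw [← hz.def, (C.isClosed_singleton hz1).closure_eq]
  exact Set.finite_singleton z

theorem finite_compl (U : C.X.Opens) [h : Nonempty U] : ((U : Set C.X)ᶜ).Finite := by
  refine C.finite_of_isClosed U.isOpen.isClosed_compl ?_
  simp only [Set.mem_compl_iff, not_not]
  exact ((genericPoint_spec C.X).mem_open_set_iff U.isOpen).mpr (by simpa using h)

instance isPrincipalIdealRing_stalk (x : C.X) : IsPrincipalIdealRing (C.X.presheaf.stalk x) := by
  have := C.regular x
  refine ((tfae_of_isNoetherianRing_of_isLocalRing_of_isDomain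
    (C.X.presheaf.stalk x)).out 5 0).mp ?_
  have h1 := (IsRegularLocalRing.iff_finrank_cotangentSpace _).mp this
  rw [ringKrullDim_stalk_eq_coheight] at h1
  have h2 := C.coheight_le_one x
  have h3 : (Module.finrank (IsLocalRing.ResidueField (C.X.presheaf.stalk x))
    (IsLocalRing.CotangentSpace (C.X.presheaf.stalk x)) : WithBot ℕ∞) ≤ 1 := by
    rw [h1]; exact_mod_cast h2
  exact_mod_cast h3

theorem isDiscreteValuationRing_stalk {x : C.X} (hx : Order.coheight x = 1) :
    IsDiscreteValuationRing (C.X.presheaf.stalk x) := by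
  refine { not_a_field' := ?_ }
  intro h
  have h1 : ringKrullDim (C.X.presheaf.stalk x) = 0 :=
    ringKrullDim_eq_zero_of_isField (IsLocalRing.isField_iff_maximalIdeal_eq.mpr h)
  rw [ringKrullDim_stalk_eq_coheight, hx] at h1
  exact absurd h1 (by decide)

theorem ord_algebraMap_nonneg {x : C.X} {a : C.X.presheaf.stalk x} :
    0 ≤ Scheme.ord (algebraMap (C.X.presheaf.stalk x) C.X.functionField a) x := by
  by_cases hx : Order.coheight x = 1
  · by_cases ha : a = 0
    · simp [ha]
    have : Ring.KrullDimLE 1 (C.X.presheaf.stalk x) := krullDimLE_of_coheight_le hx.le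
    rw [Scheme.le_ord_iff hx (by simpa using ha)]
    exact Ring.ordFrac_ge_one_of_ne_zero ha
  · rw [Scheme.ord_eq_zero_of_coheight_neq_one hx]

theorem ord_algebraMap_eq_zero_iff {x : C.X} (hx : Order.coheight x = 1)
    {a : C.X.presheaf.stalk x} (ha : a ≠ 0) :
    Scheme.ord (algebraMap (C.X.presheaf.stalk x) C.X.functionField a) x = 0 ↔ IsUnit a := by
  have := C.isDiscreteValuationRing_stalk hx
  have : Ring.KrullDimLE 1 (C.X.presheaf.stalk x) := krullDimLE_of_coheight_le hx.le
  rw [Scheme.ord_eq_iff hx (by simpa using ha),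
    Ring.isUnit_iff_ordFrac_one_of_isDiscreteValuationRing (K := C.X.functionField)]
  rfl

theorem ord_algebraMap_of_isUnit {x : C.X} {a : C.X.presheaf.stalk x} (ha : IsUnit a) :
    Scheme.ord (algebraMap (C.X.presheaf.stalk x) C.X.functionField a) x = 0 := by
  by_cases hx : Order.coheight x = 1
  · exact (C.ord_algebraMap_eq_zero_iff hx ha.ne_zero).mpr ha
  · rw [Scheme.ord_eq_zero_of_coheight_neq_one hx]

theorem ord_inv {f : C.X.functionField} (hf : f ≠ 0) (x : C.X) :
    Scheme.ord f⁻¹ x = -Scheme.ord f x := by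
  have h1 := Scheme.ord_mul (x := x) hf (inv_ne_zero hf)
  have h2 := C.ord_algebraMap_of_isUnit (x := x) isUnit_one
  rw [map_one] at h2
  rw [mul_inv_cancel₀ hf, h2] at h1
  omega

theorem exists_algebraMap_eq {x : C.X} (hx : Order.coheight x = 1) {f : C.X.functionField}
    (hf : f ≠ 0) (h : 0 ≤ Scheme.ord f x) :
    ∃ a, algebraMap (C.X.presheaf.stalk x) C.X.functionField a = f := by
  have := C.isDiscreteValuationRing_stalk hx
  rcases ValuationRing.isInteger_or_isInteger (C.X.presheaf.stalk x) f with ⟨a, ha⟩ | ⟨a, ha⟩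
  · exact ⟨a, ha⟩
  have ha0 : a ≠ 0 := by
    rintro rfl
    exact inv_ne_zero hf (by rw [← ha, map_zero])
  have h1 := C.ord_algebraMap_nonneg (a := a)
  have h2 : IsUnit a := by
    rw [← C.ord_algebraMap_eq_zero_iff hx ha0]
    rw [ha, C.ord_inv hf] at h1 ⊢
    omega
  obtain ⟨b, rfl⟩ := h2
  refine ⟨(b⁻¹ : (C.X.presheaf.stalk x)ˣ), ?_⟩
  rw [← inv_inj, ← ha, eq_comm]
  refine eq_inv_of_mul_eq_one_left ?_
  rw [← map_mul, Units.mul_inv, map_one]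

theorem finite_support_ord {f : C.X.functionField} (hf : f ≠ 0) :
    {x | Scheme.ord f x ≠ 0}.Finite := by
  obtain ⟨U, -, g, hU, rfl, hg⟩ := exists_isUnit_germ_eq C.X f hf
  refine (C.finite_compl U).subset fun x hx hxU ↦ hx (Scheme.ord_of_isUnit hg hxU)

end NonsingularProjectiveCurve

namespace NonsingularProjectiveCurve

variable {k : Type u} [Field k] (C : NonsingularProjectiveCurve k)

instance : Nonempty ((⊤ : C.X.Opens)) := (inferInstance : Nonempty C.X).map fun x ↦ ⟨x, trivial⟩

instance : C.X.IsSeparated := by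
  have : IsSeparated (C.toSpec ≫ Limits.terminal.from (Spec (CommRingCat.of k))) := inferInstance
  rw [Limits.terminal.comp_from] at this
  exact ⟨this⟩

theorem exists_ord_neg [IsAlgClosed k] {x y : C.X}
    (hy : Order.coheight y = 1) (hxy : x ≠ y) :
    ∃ h : C.X.functionField, h ≠ 0 ∧ 0 ≤ Scheme.ord h x ∧ Scheme.ord h y < 0 := by
  by_contra! hcon
  have hle : (algebraMap (C.X.presheaf.stalk x) C.X.functionField).range ≤
      (algebraMap (C.X.presheaf.stalk y) C.X.functionField).range := by
    rintro _ ⟨a, rfl⟩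
    by_cases ha : a = 0
    · simp [ha]
    have ha' : algebraMap (C.X.presheaf.stalk x) C.X.functionField a ≠ 0 := by simpa using ha
    exact C.exists_algebraMap_eq hy ha' (hcon _ ha' C.ord_algebraMap_nonneg)
  have hinj : Function.Injective (algebraMap (C.X.presheaf.stalk y) C.X.functionField) :=
    IsFractionRing.injective _ _
  let e := RingEquiv.ofBijective
    (algebraMap (C.X.presheaf.stalk y) C.X.functionField).rangeRestrict
    ⟨fun a b h ↦ hinj (congrArg Subtype.val h), RingHom.rangeRestrict_surjective _⟩
  let ψ : C.X.presheaf.stalk x →+* C.X.presheaf.stalk y :=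
    (e.symm : _ →+* _).comp ((Subring.inclusion hle).comp (RingHom.rangeRestrict _))
  have hψ : (algebraMap (C.X.presheaf.stalk y) C.X.functionField).comp ψ =
      algebraMap (C.X.presheaf.stalk x) C.X.functionField := by
    ext a
    exact congrArg Subtype.val (e.apply_symm_apply _)
  have hsx : genericPoint C.X ⤳ x := genericPoint_specializes x
  have hsy : genericPoint C.X ⤳ y := genericPoint_specializes y
  have hψ' : CommRingCat.ofHom ψ ≫ C.X.presheaf.stalkSpecializes hsy =
      C.X.presheaf.stalkSpecializes hsx := by
    ext a
    exact DFunLike.congr_fun hψ a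
  have hdom : IsDominant (Spec.map (C.X.presheaf.stalkSpecializes hsy)) := by
    refine isDominant_of_of_appTop_injective ?_
    have h1 := Scheme.ΓSpecIso_naturality (C.X.presheaf.stalkSpecializes hsy)
    rw [← Iso.eq_comp_inv] at h1
    rw [h1]
    simp only [CommRingCat.hom_comp, RingHom.coe_comp, Category.assoc]
    refine Function.Injective.comp (Function.Injective.comp ?_ hinj) ?_
    · exact (ConcreteCategory.bijective_of_isIso (Scheme.ΓSpecIso _).inv).1
    · exact (ConcreteCategory.bijective_of_isIso (Scheme.ΓSpecIso _).hom).1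
  have heq : Spec.map (CommRingCat.ofHom ψ) ≫ C.X.fromSpecStalk x = C.X.fromSpecStalk y := by
    refine ext_of_isDominant (Spec.map (C.X.presheaf.stalkSpecializes hsy)) ?_
    rw [← Spec.map_comp_assoc, hψ', Scheme.SpecMap_stalkSpecializes_fromSpecStalk,
      Scheme.SpecMap_stalkSpecializes_fromSpecStalk]
  have hyx : y ⤳ x := by
    have h1 : y ∈ Set.range (C.X.fromSpecStalk x) := by
      rw [← Scheme.fromSpecStalk_closedPoint (x := y), ← heq]
      exact ⟨_, rfl⟩
    rwa [Scheme.range_fromSpecStalk] at h1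
  have h2 := hyx.mem_closure
  rw [(C.isClosed_singleton hy).closure_eq] at h2
  exact hxy h2

/-- The inclusion of the constants in the global functions. -/
noncomputable def constants : k →+* Γ(C.X, ⊤) :=
  ((Scheme.ΓSpecIso (.of k)).inv ≫ C.toSpec.appTop).hom

theorem toSpec_eq : C.toSpec = C.X.toSpecΓ ≫ Spec.map (CommRingCat.ofHom C.constants) := by
  rw [constants, CommRingCat.ofHom_hom, Spec.map_comp, ← Scheme.toSpecΓ_naturality_assoc]
  simp

theorem constants_bijective [IsAlgClosed k] : Function.Bijective C.constants := by
  have h : Function.Bijective C.constants := by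
    refine IsAlgClosed.ringHom_bijective_of_isIntegral _ ?_
    have h1 : C.toSpec.appTop.hom.IsIntegral := isIntegral_appTop_of_universallyClosed C.toSpec
    exact RingHom.isIntegral_respectsIso.2 (e := (Scheme.ΓSpecIso _).symm.commRingCatIsoToRingEquiv)
      _ h1
  exact h

theorem exists_sub_constant_notIsUnit [IsAlgClosed k] {x : C.X} (hx : Order.coheight x = 1)
    (a : C.X.presheaf.stalk x) :
    ∃ c : k, ¬ IsUnit (a - C.X.presheaf.germ ⊤ x trivial (C.constants c)) := by
  let i := (residueFieldIsoBase C.toSpec x (C.isClosed_singleton hx)).inv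
  have hi : i = CommRingCat.ofHom C.constants ≫ C.X.presheaf.germ ⊤ x trivial ≫ C.X.residue x := by
    apply Spec.map_injective
    rw [SpecMap_residueFieldIsoBase_inv, Spec.map_comp, Spec.map_comp, toSpec_eq,
      Scheme.fromSpecResidueField, Category.assoc, Category.assoc,
      Scheme.fromSpecStalk_toSpecΓ_assoc]
  obtain ⟨c, hc⟩ := (ConcreteCategory.bijective_of_isIso i).2 (C.X.residue x a)
  refine ⟨c, fun hu ↦ ?_⟩
  have h1 := hu.map (C.X.residue x).hom
  rw [map_sub] at h1
  have h2 : (C.X.residue x).hom (C.X.presheaf.germ ⊤ x trivial (C.constants c)) = i c := by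
    rw [hi]; rfl
  rw [h2] at h1
  erw [hc] at h1
  rw [sub_self] at h1
  exact not_isUnit_zero h1

theorem exists_germ_eq_of_forall_ord_nonneg {f : C.X.functionField} (hf : f ≠ 0)
    (h : ∀ x, 0 ≤ Scheme.ord f x) : ∃ g : Γ(C.X, ⊤), C.X.germToFunctionField ⊤ g = f := by
  have h1 : ∀ x : C.X, ∃ (U : C.X.Opens) (_ : x ∈ U) (hU : Nonempty U) (s : Γ(C.X, U)),
      C.X.germToFunctionField U s = f := by
    intro x
    obtain ⟨a, ha⟩ : ∃ a, algebraMap (C.X.presheaf.stalk x) C.X.functionField a = f := by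
      by_cases hx : Order.coheight x = 1
      · exact C.exists_algebraMap_eq hx hf (h x)
      · rw [coheight_eq_one_iff, not_not] at hx
        subst hx
        refine ⟨f, ?_⟩
        rw [RingHom.algebraMap_toAlgebra, TopCat.Presheaf.stalkSpecializes_refl]
        rfl
    obtain ⟨U, hU, s, rfl⟩ := C.X.presheaf.exists_germ_eq a
    have : Nonempty U := ⟨⟨x, hU⟩⟩
    exact ⟨U, hU, this, s, by rw [← ha, Scheme.algebraMap_germ_eq_germToFunctionField]⟩
  choose U hxU hne s hs using h1
  obtain ⟨g, hg, -⟩ := C.X.sheaf.existsUnique_gluing' U ⊤ (fun x ↦ homOfLE le_top)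
    (fun x _ ↦ Opens.mem_iSup.mpr ⟨x, hxU x⟩) s (by
      intro x y
      have hV : Nonempty ((U x ⊓ U y : C.X.Opens)) := by
        obtain ⟨z, hz⟩ := nonempty_preirreducible_inter (U x).isOpen (U y).isOpen
          (Set.nonempty_coe_sort.mp (hne x)) (Set.nonempty_coe_sort.mp (hne y))
        exact ⟨⟨z, hz⟩⟩
      apply C.X.germToFunctionField_injective (U x ⊓ U y)
      have hx := hs x
      have hy := hs y
      rw [← hx] at hy
      erw [TopCat.Presheaf.germ_res_apply, TopCat.Presheaf.germ_res_apply]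
      exact hy.symm)
  obtain ⟨x⟩ : Nonempty C.X := inferInstance
  refine ⟨g, ?_⟩
  rw [← hs x, ← hg x]
  erw [TopCat.Presheaf.germ_res_apply]

noncomputable instance : Algebra k C.X.functionField :=
  ((C.X.germToFunctionField ⊤).hom.comp C.constants).toAlgebra

theorem exists_ord_sub_algebraMap_pos [IsAlgClosed k] {x : C.X} (hx : Order.coheight x = 1)
    {f : C.X.functionField} (hf : f ≠ 0) (h : 0 ≤ Scheme.ord f x) :
    ∃ c : k, f = algebraMap k C.X.functionField c ∨
      0 < Scheme.ord (f - algebraMap k C.X.functionField c) x := by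
  obtain ⟨a, rfl⟩ := C.exists_algebraMap_eq hx hf h
  obtain ⟨c, hc⟩ := C.exists_sub_constant_notIsUnit hx a
  have h1 : algebraMap (C.X.presheaf.stalk x) C.X.functionField
      (C.X.presheaf.germ ⊤ x trivial (C.constants c)) = algebraMap k C.X.functionField c :=
    C.X.algebraMap_germ_eq_germToFunctionField (U := ⊤) (x := x) trivial _
  refine ⟨c, or_iff_not_imp_left.mpr fun hne ↦ ?_⟩
  rw [← h1] at hne ⊢
  rw [← map_sub]
  have h2 : a - C.X.presheaf.germ ⊤ x trivial (C.constants c) ≠ 0 :=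
    fun h2 ↦ hne (congrArg _ (sub_eq_zero.mp h2))
  have h3 := mt (C.ord_algebraMap_eq_zero_iff hx h2).mp hc
  exact lt_of_le_of_ne C.ord_algebraMap_nonneg (Ne.symm h3)

theorem exists_ord_eq_one {x : C.X} (hx : Order.coheight x = 1) :
    ∃ π : C.X.functionField, π ≠ 0 ∧ Scheme.ord π x = 1 := by
  have := C.isDiscreteValuationRing_stalk hx
  have : Ring.KrullDimLE 1 (C.X.presheaf.stalk x) := krullDimLE_of_coheight_le hx.le
  obtain ⟨π, hπ⟩ := IsDiscreteValuationRing.exists_irreducible (C.X.presheaf.stalk x)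
  have h0 : algebraMap (C.X.presheaf.stalk x) C.X.functionField π ≠ 0 := by
    simpa using hπ.ne_zero
  exact ⟨_, h0, (Scheme.ord_eq_iff hx h0).mpr (Ring.ordFrac_irreducible hπ)⟩

theorem exists_eq_algebraMap_of_forall_ord_nonneg [IsAlgClosed k] {f : C.X.functionField}
    (hf : f ≠ 0) (h : ∀ x, Order.coheight x = 1 → 0 ≤ Scheme.ord f x) :
    ∃ c : k, f = algebraMap k C.X.functionField c := by
  obtain ⟨g, rfl⟩ := C.exists_germ_eq_of_forall_ord_nonneg hf fun x ↦ by
    by_cases hx : Order.coheight x = 1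
    · exact h x hx
    · rw [Scheme.ord_eq_zero_of_coheight_neq_one hx]
  obtain ⟨c, rfl⟩ := C.constants_bijective.2 g
  exact ⟨c, rfl⟩

/-- The places of the function field of a curve given by its closed points. -/
noncomputable def places [IsAlgClosed k] :
    CompletePlaces k C.X.functionField {x : C.X // Order.coheight x = 1} where
  v x f := Scheme.ord f x
  map_mul _ _ _ hf hg := Scheme.ord_mul hf hg
  map_add x _ _ _ _ hfg := by
    have := C.isDiscreteValuationRing_stalk x.2
    exact Scheme.ord_add hfg
  finite_support hf := (C.finite_support_ord hf).preimage Subtype.val_injective.injOn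
  map_algebraMap x c hc :=
    Scheme.ord_of_isUnit (U := ⊤) ((isUnit_iff_ne_zero.mpr hc).map C.constants) trivial
  residue x _ hf hv := C.exists_ord_sub_algebraMap_pos x.2 hf hv.ge
  uniformizer x := C.exists_ord_eq_one x.2
  incomparable {x y} hxy := C.exists_ord_neg y.2 fun h ↦ hxy (Subtype.ext h)
  global hf h := C.exists_eq_algebraMap_of_forall_ord_nonneg hf fun x hx ↦ h ⟨x, hx⟩

/-- A principal divisor on a complete curve has degree zero. -/
theorem finsum_ord_eq_zero [IsAlgClosed k] {f : C.X.functionField} (hf : f ≠ 0) :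
    ∑ᶠ x, Scheme.ord f x = 0 := by
  rw [← C.places.finsum_eq_zero hf]
  refine Eq.trans ?_ (finsum_subtype_eq_finsum_cond (f := fun x ↦ Scheme.ord f x)
    (fun x : C.X ↦ Order.coheight x = 1)).symm
  refine finsum_congr fun x ↦ ?_
  by_cases hx : Order.coheight x = 1
  · simp [hx]
  · simp [hx]

end NonsingularProjectiveCurve

namespace AlgebraicGeometry.Scheme.Modules

variable {X : Scheme.{u}} {M N L : X.Modules} {x y : X} {U V : X.Opens}

/-- The stalk of a sheaf of modules. -/
def Stalk (M : X.Modules) (x : X) : Type u := M.presheaf.stalk x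

noncomputable instance : AddCommGroup (M.Stalk x) :=
  inferInstanceAs (AddCommGroup (M.presheaf.stalk x))

noncomputable instance : Module (X.presheaf.stalk x) (M.Stalk x) :=
  letI P : _root_.PresheafOfModules.{u} (X.presheaf ⋙ forget₂ CommRingCat.{u} RingCat.{u}) := M.val
  inferInstanceAs (Module (X.presheaf.stalk x) (TopCat.Presheaf.stalk (C := Ab.{u}) P.presheaf x))

/-- The germ at `x` of a section. -/
noncomputable def germ (M : X.Modules) (U : X.Opens) (hx : x ∈ U) : Γ(M, U) →+ M.Stalk x :=
  (TopCat.Presheaf.germ M.presheaf U x hx).hom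

theorem germ_smul (hx : x ∈ U) (r : Γ(X, U)) (m : Γ(M, U)) :
    M.germ U hx (r • m) = X.presheaf.germ U x hx r • M.germ U hx m :=
  PresheafOfModules.germ_smul (R := X.presheaf) M.val x U hx r m

theorem germ_map (h : V ≤ U) (hx : x ∈ V) (m : Γ(M, U)) :
    M.germ V hx (M.presheaf.map (homOfLE h).op m) = M.germ U (h hx) m :=
  TopCat.Presheaf.germ_res_apply _ _ _ _ _

theorem exists_germ_eq (m : M.Stalk x) : ∃ (U : X.Opens) (hx : x ∈ U) (s : Γ(M, U)),
    M.germ U hx s = m :=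
  TopCat.Presheaf.exists_germ_eq M.presheaf m

theorem exists_map_eq_of_germ_eq (hx : x ∈ U) {s t : Γ(M, U)} (h : M.germ U hx s = M.germ U hx t) :
    ∃ (V : X.Opens) (hV : V ≤ U), x ∈ V ∧
      M.presheaf.map (homOfLE hV).op s = M.presheaf.map (homOfLE hV).op t := by
  obtain ⟨W, hW, iU, iV, e⟩ := TopCat.Presheaf.germ_eq M.presheaf x hx hx s t h
  exact ⟨W, iU.le, hW, e⟩

theorem eq_of_germ_eq {s t : Γ(M, U)} (h : ∀ (x : X) (hx : x ∈ U), M.germ U hx s = M.germ U hx t) :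
    s = t :=
  TopCat.Presheaf.section_ext ⟨M.presheaf, M.isSheaf⟩ U s t h

/-- The map induced on stalks. -/
noncomputable def stalkMap (φ : M ⟶ N) (x : X) : M.Stalk x →ₗ[X.presheaf.stalk x] N.Stalk x where
  toFun := ((TopCat.Presheaf.stalkFunctor Ab x).map φ.mapPresheaf).hom
  map_add' := map_add _
  map_smul' := by
    intro r m
    obtain ⟨U, hU, m, rfl⟩ := exists_germ_eq m
    obtain ⟨V, hVU, hV, r, rfl⟩ := X.presheaf.exists_le_germ_eq r hU
    have key : ∀ (W : X.Opens) (hW : x ∈ W) (s : Γ(M, W)),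
      ((TopCat.Presheaf.stalkFunctor Ab x).map φ.mapPresheaf).hom (M.germ W hW s) =
        N.germ W hW (φ.app W s) := fun W hW s ↦
      TopCat.Presheaf.stalkFunctor_map_germ_apply W x hW φ.mapPresheaf s
    rw [← germ_map hVU hV, ← germ_smul, key, key, Hom.app_smul, germ_smul]
    rfl

theorem stalkMap_germ (φ : M ⟶ N) (hx : x ∈ U) (s : Γ(M, U)) :
    stalkMap φ x (M.germ U hx s) = N.germ U hx (φ.app U s) :=
  TopCat.Presheaf.stalkFunctor_map_germ_apply U x hx φ.mapPresheaf s

theorem stalkMap_comp (φ : M ⟶ N) (ψ : N ⟶ L) (x : X) :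
    stalkMap (φ ≫ ψ) x = (stalkMap ψ x).comp (stalkMap φ x) := by
  ext m
  obtain ⟨U, hU, m, rfl⟩ := exists_germ_eq m
  simp only [LinearMap.comp_apply, stalkMap_germ]
  rfl

theorem stalkMap_zero (x : X) : stalkMap (0 : M ⟶ N) x = 0 := by
  ext m
  obtain ⟨U, hU, m, rfl⟩ := exists_germ_eq m
  rw [stalkMap_germ]
  exact map_zero _

/-- The specialization map of stalks. -/
noncomputable def specialize (M : X.Modules) (h : y ⤳ x) : M.Stalk x →+ M.Stalk y :=
  (TopCat.Presheaf.stalkSpecializes M.presheaf h).hom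

theorem specialize_germ (h : y ⤳ x) (hx : x ∈ U) (s : Γ(M, U)) :
    M.specialize h (M.germ U hx s) = M.germ U (h.mem_open U.isOpen hx) s :=
  congr($(TopCat.Presheaf.germ_stalkSpecializes M.presheaf hx h) s)

theorem specialize_smul (h : y ⤳ x) (r : X.presheaf.stalk x) (m : M.Stalk x) :
    M.specialize h (r • m) = X.presheaf.stalkSpecializes h r • M.specialize h m := by
  obtain ⟨U, hU, m, rfl⟩ := exists_germ_eq m
  obtain ⟨V, hVU, hV, r, rfl⟩ := X.presheaf.exists_le_germ_eq r hU
  rw [← germ_map hVU hV, ← germ_smul, specialize_germ, specialize_germ, germ_smul]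
  congr 1
  exact congr($(TopCat.Presheaf.germ_stalkSpecializes X.presheaf hV h) r).symm

theorem stalkMap_specialize (φ : M ⟶ N) (h : y ⤳ x) (m : M.Stalk x) :
    stalkMap φ y (M.specialize h m) = N.specialize h (stalkMap φ x m) := by
  obtain ⟨U, hU, m, rfl⟩ := exists_germ_eq m
  rw [specialize_germ, stalkMap_germ, stalkMap_germ, specialize_germ]

section Exact

theorem app_injective (φ : M ⟶ N) [Mono φ] (U : X.Opens) : Function.Injective (φ.app U) := by
  have h1 : Mono ((toPresheaf X).map φ) := inferInstance
  have h2 : Mono (((toPresheaf X).map φ).app (.op U)) := inferInstance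
  exact (AddCommGrpCat.mono_iff_injective _).mp h2

theorem stalkMap_injective (φ : M ⟶ N) [Mono φ] (x : X) : Function.Injective (stalkMap φ x) :=
  TopCat.Presheaf.stalkFunctor_map_injective_of_app_injective (f := φ.mapPresheaf)
    (fun U ↦ app_injective φ U) x

theorem isIso_of_stalkMap_bijective (φ : M ⟶ N) (h : ∀ x, Function.Bijective (stalkMap φ x)) :
    IsIso φ := by
  rw [Hom.isIso_iff_isIso_app]
  intro U
  rw [ConcreteCategory.isIso_iff_bijective]
  exact TopCat.Presheaf.app_bijective_of_stalkFunctor_map_bijective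
    (F := ⟨M.presheaf, M.isSheaf⟩) (G := ⟨N.presheaf, N.isSheaf⟩) ⟨φ.mapPresheaf⟩ U fun x _ ↦ h x

theorem exists_app_eq_of_shortExact {S : ShortComplex X.Modules} (hS : S.ShortExact)
    (s : Γ(S.X₂, U)) (hs : S.g.app U s = 0) : ∃ t, S.f.app U t = s := by
  let H : X.Modules ⥤ Ab := toPresheaf X ⋙ (CategoryTheory.evaluation X.Opensᵒᵖ Ab.{u}).obj (.op U)
  have : Limits.PreservesFiniteLimits
      ((CategoryTheory.evaluation X.Opensᵒᵖ Ab.{u}).obj (.op U)) := ⟨fun _ _ _ ↦ inferInstance⟩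
  have : Limits.PreservesFiniteLimits H := Limits.comp_preservesFiniteLimits _ _
  have : H.PreservesZeroMorphisms := ⟨fun _ _ ↦ rfl⟩
  have : Mono S.f := hS.mono_f
  have h := hS.exact.map_of_mono_of_preservesKernel H inferInstance inferInstance
  rw [ShortComplex.ab_exact_iff] at h
  exact h s hs

theorem epi_toSheaf_map {J : GrothendieckTopology X.Opens} {R : Sheaf J RingCat.{u}}
    {A B : SheafOfModules.{u} R} (φ : A ⟶ B) [Epi φ] :
    Epi ((SheafOfModules.toSheaf R).map φ) := by
  let adj := PresheafOfModules.sheafificationAdjunction.{u} (𝟙 R.obj)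
  let a := PresheafOfModules.sheafification.{u} (𝟙 R.obj)
  let F := SheafOfModules.forget.{u} R ⋙ PresheafOfModules.restrictScalars (𝟙 R.obj)
  let T := SheafOfModules.toSheaf.{u} R
  have hiso : ∀ B, IsIso (adj.counit.app B) := fun B ↦ inferInstance
  have hfac : a.map (F.map φ) = adj.counit.app A ≫ φ ≫ inv (adj.counit.app B) := by
    rw [← Category.assoc, IsIso.eq_comp_inv]
    exact adj.counit.naturality φ
  have h1 : Epi (a.map (F.map φ)) := by
    rw [hfac]
    infer_instance
  have : a.PreservesZeroMorphisms := inferInstance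
  have : Limits.PreservesFiniteColimits a :=
    ⟨fun _ _ _ ↦ adj.leftAdjoint_preservesColimits.1⟩
  have : Limits.PreservesFiniteColimits (a ⋙ T) :=
    inferInstanceAs (Limits.PreservesFiniteColimits
      (PresheafOfModules.toPresheaf.{u} R.obj ⋙ presheafToSheaf J AddCommGrpCat.{u}))
  have h2 : Limits.IsZero (a.obj (Limits.cokernel (F.map φ))) :=
    (Limits.isZero_cokernel_of_epi (a.map (F.map φ))).of_iso (Limits.PreservesCokernel.iso a _)
  have h3 : Epi ((a ⋙ T).map (F.map φ)) :=
    Preadditive.epi_of_isZero_cokernel _ ((T.map_isZero h2).of_iso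
      (Limits.PreservesCokernel.iso (a ⋙ T) (F.map φ)).symm)
  have h4 : T.map φ = inv (T.map (adj.counit.app A)) ≫ (a ⋙ T).map (F.map φ) ≫
      T.map (adj.counit.app B) := by
    rw [Functor.comp_map, hfac]
    simp
  rw [h4]
  infer_instance

theorem stalkMap_surjective (φ : M ⟶ N) [Epi φ] (x : X) : Function.Surjective (stalkMap φ x) := by
  have h0 : @Epi (SheafOfModules.{u} X.ringCatSheaf) _ M N φ := ‹Epi φ›
  have h : Epi ((SheafOfModules.toSheaf X.ringCatSheaf).map φ) := epi_toSheaf_map _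
  rw [← Sheaf.isLocallySurjective_iff_epi'] at h
  exact (TopCat.Presheaf.locally_surjective_iff_surjective_on_stalks φ.mapPresheaf).mp h x

theorem stalkMap_exact {S : ShortComplex X.Modules} (hS : S.ShortExact) (x : X) :
    Function.Exact (stalkMap S.f x) (stalkMap S.g x) := by
  intro m
  constructor
  · intro hm
    obtain ⟨U, hU, m, rfl⟩ := exists_germ_eq m
    rw [stalkMap_germ, ← map_zero (S.X₃.germ U hU)] at hm
    obtain ⟨V, hV, hxV, h⟩ := exists_map_eq_of_germ_eq hU hm
    rw [map_zero] at h
    obtain ⟨t, ht⟩ := exists_app_eq_of_shortExact hS (S.X₂.presheaf.map (homOfLE hV).op m) (by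
      rw [← h]
      exact congr($(S.g.mapPresheaf.naturality (homOfLE hV).op) m))
    exact ⟨S.X₁.germ V hxV t, by rw [stalkMap_germ, ht, germ_map]⟩
  · rintro ⟨t, rfl⟩
    rw [← LinearMap.comp_apply, ← stalkMap_comp, S.zero, stalkMap_zero]
    rfl

end Exact

end AlgebraicGeometry.Scheme.Modules

theorem TopologicalSpace.Opens.exists_le_forall_le {T : Type*} [TopologicalSpace T] {ι : Type*}
    [Finite ι] {x : T} (U : Opens T) (hx : x ∈ U) (W : ι → Opens T) (hW : ∀ i, x ∈ W i) :
    ∃ V ≤ U, x ∈ V ∧ ∀ i, V ≤ W i := by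
  cases nonempty_fintype ι
  refine ⟨U ⊓ Finset.univ.inf W, inf_le_left, ⟨hx, ?_⟩, fun i ↦
    inf_le_right.trans (Finset.inf_le (Finset.mem_univ i))⟩
  rw [SetLike.mem_coe, ← SetLike.mem_coe, Opens.coe_finset_inf]
  simpa using hW

namespace AlgebraicGeometry.Scheme

variable {X : Scheme.{u}} {M N L : X.Modules} {x y : X} {U V : X.Opens} {ι : Type*}

theorem exists_germ_eq_of_finite [Finite ι] (hx : x ∈ U) (c : ι → X.presheaf.stalk x) :
    ∃ (V : X.Opens) (_ : V ≤ U) (hV : x ∈ V) (r : ι → Γ(X, V)),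
      ∀ i, X.presheaf.germ V x hV (r i) = c i := by
  choose W hWU hW r hr using fun i ↦ X.presheaf.exists_le_germ_eq (c i) hx
  obtain ⟨V, hVU, hV, hVW⟩ := U.exists_le_forall_le hx W hW
  exact ⟨V, hVU, hV, fun i ↦ X.presheaf.map (homOfLE (hVW i)).op (r i), fun i ↦ by
    rw [← hr i]; exact TopCat.Presheaf.germ_res_apply _ _ _ _ _⟩

namespace Modules

theorem exists_le_germ_eq (hx : x ∈ U) (m : M.Stalk x) :
    ∃ (V : X.Opens) (_ : V ≤ U) (hV : x ∈ V) (s : Γ(M, V)), M.germ V hV s = m := by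
  obtain ⟨W, hW, s, rfl⟩ := exists_germ_eq m
  exact ⟨U ⊓ W, inf_le_left, ⟨hx, hW⟩, M.presheaf.map (homOfLE inf_le_right).op s, germ_map _ _ _⟩

theorem exists_germ_eq_of_finite [Finite ι] (hx : x ∈ U) (m : ι → M.Stalk x) :
    ∃ (V : X.Opens) (_ : V ≤ U) (hV : x ∈ V) (s : ι → Γ(M, V)), ∀ i, M.germ V hV (s i) = m i := by
  choose W hWU hW r hr using fun i ↦ exists_le_germ_eq hx (m i)
  obtain ⟨V, hVU, hV, hVW⟩ := U.exists_le_forall_le hx W hW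
  exact ⟨V, hVU, hV, fun i ↦ M.presheaf.map (homOfLE (hVW i)).op (r i), fun i ↦ by
    rw [germ_map, hr i]⟩

theorem germ_sum_smul [Fintype ι] (hx : x ∈ V) (hV : V ≤ U) (c : ι → Γ(X, V))
    (s : ι → Γ(M, U)) :
    M.germ V hx (∑ i, c i • M.presheaf.map (homOfLE hV).op (s i)) =
      ∑ i, X.presheaf.germ V x hx (c i) • M.germ U (hV hx) (s i) := by
  simp only [map_sum, germ_smul, germ_map]

theorem map_map {W : X.Opens} (h : W ≤ V) (h' : V ≤ U) (s : Γ(M, U)) :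
    M.presheaf.map (homOfLE h).op (M.presheaf.map (homOfLE h').op s) =
      M.presheaf.map (homOfLE (h.trans h')).op s := by
  rw [← CategoryTheory.comp_apply, ← Functor.map_comp]
  rfl

theorem map_sum_smul {W : X.Opens} [Fintype ι] (hW : W ≤ V) (hV : V ≤ U) (c : ι → Γ(X, V))
    (s : ι → Γ(M, U)) :
    M.presheaf.map (homOfLE hW).op (∑ i, c i • M.presheaf.map (homOfLE hV).op (s i)) =
      ∑ i, X.presheaf.map (homOfLE hW).op (c i) •
        M.presheaf.map (homOfLE (hW.trans hV)).op (s i) := by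
  simp only [map_sum, map_smul, map_map]

/-- Sections whose germs at a point form a basis of the stalk. -/
def IsBasisAt (s : ι → Γ(M, U)) (hx : x ∈ U) : Prop :=
  LinearIndependent (X.presheaf.stalk x) (fun i ↦ M.germ U hx (s i)) ∧
    Submodule.span (X.presheaf.stalk x) (Set.range fun i ↦ M.germ U hx (s i)) = ⊤

/-- Coordinates on `V` determine a section. -/
theorem coordinates_injective [Fintype ι] {s : ι → Γ(M, U)}
    (hs : ∀ (x : X) (hx : x ∈ U), IsBasisAt s hx) (hV : V ≤ U) :
    Function.Injective
      (fun c : ι → Γ(X, V) ↦ ∑ i, c i • M.presheaf.map (homOfLE hV).op (s i)) := by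
  intro c c' h
  funext i
  refine TopCat.Presheaf.section_ext X.sheaf V _ _ fun x hx ↦ ?_
  have h1 := congrArg (M.germ V hx) h
  simp only [germ_sum_smul] at h1
  rw [← sub_eq_zero, ← Finset.sum_sub_distrib] at h1
  simp only [← sub_smul] at h1
  exact sub_eq_zero.mp (Fintype.linearIndependent_iff.mp (hs x (hV hx)).1 _ h1 i)

theorem coordinates_surjective [Fintype ι] {s : ι → Γ(M, U)}
    (hs : ∀ (x : X) (hx : x ∈ U), IsBasisAt s hx) (hV : V ≤ U) :
    Function.Surjective
      (fun c : ι → Γ(X, V) ↦ ∑ i, c i • M.presheaf.map (homOfLE hV).op (s i)) := by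
  intro m
  have hloc : ∀ x : V, ∃ (W : X.Opens) (hWV : W ≤ V) (_ : x.1 ∈ W) (c : ι → Γ(X, W)),
      ∑ i, c i • M.presheaf.map (homOfLE (hWV.trans hV)).op (s i) =
        M.presheaf.map (homOfLE hWV).op m := by
    rintro ⟨x, hx⟩
    have h1 : M.germ V hx m ∈ Submodule.span (X.presheaf.stalk x)
      (Set.range fun i ↦ M.germ U (hV hx) (s i)) := by rw [(hs x (hV hx)).2]; trivial
    obtain ⟨c, hc⟩ := (Submodule.mem_span_range_iff_exists_fun _).mp h1
    obtain ⟨W, hWV, hxW, r, hr⟩ := Scheme.exists_germ_eq_of_finite hx c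
    have h2 : M.germ W hxW (∑ i, r i • M.presheaf.map (homOfLE (hWV.trans hV)).op (s i)) =
        M.germ W hxW (M.presheaf.map (homOfLE hWV).op m) := by
      rw [germ_sum_smul, germ_map, ← hc]
      simp only [hr]
    obtain ⟨W', hW', hxW', h3⟩ := exists_map_eq_of_germ_eq hxW h2
    rw [map_sum_smul, map_map] at h3
    exact ⟨W', hW'.trans hWV, hxW', _, h3⟩
  choose W hWV hxW c hc using hloc
  have hglue : ∀ i, ∃ g : Γ(X, V), ∀ x, X.presheaf.map (homOfLE (hWV x)).op g = c x i := by
    intro i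
    obtain ⟨g, hg, -⟩ := X.sheaf.existsUnique_gluing' W V (fun x ↦ homOfLE (hWV x))
      (fun x hx ↦ Opens.mem_iSup.mpr ⟨⟨x, hx⟩, hxW ⟨x, hx⟩⟩) (fun x ↦ c x i) (by
        intro x y
        have h1 := congrArg (M.presheaf.map (homOfLE (inf_le_left : W x ⊓ W y ≤ W x)).op) (hc x)
        have h2 := congrArg (M.presheaf.map (homOfLE (inf_le_right : W x ⊓ W y ≤ W y)).op) (hc y)
        rw [map_sum_smul, map_map] at h1 h2
        exact congrFun (coordinates_injective hs
          (inf_le_left.trans ((hWV x).trans hV) : W x ⊓ W y ≤ U) (h1.trans h2.symm)) i)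
    exact ⟨g, hg⟩
  choose g hg using hglue
  refine ⟨g, eq_of_germ_eq fun x hx ↦ ?_⟩
  have h1 := congrArg (M.germ (W ⟨x, hx⟩) (hxW ⟨x, hx⟩)) (hc ⟨x, hx⟩)
  rw [germ_map, germ_sum_smul] at h1
  rw [germ_sum_smul, ← h1]
  refine Finset.sum_congr rfl fun i _ ↦ ?_
  rw [← hg i ⟨x, hx⟩]
  congr 1
  exact (TopCat.Presheaf.germ_res_apply _ _ _ _ _).symm

end Modules

end AlgebraicGeometry.Scheme

namespace SheafFrame

open Scheme.Modules

variable {X : Scheme.{u}} {M : X.Modules} {n : ℕ} {x : X} {U V : X.Opens} {ι : Type*}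

/-- Sections that form a basis of every stalk form a frame. -/
def ofIsBasisAt (hU : Nonempty U) (s : Fin n → Γ(M, U))
    (hs : ∀ (x : X) (hx : x ∈ U), IsBasisAt s hx) : SheafFrame M n where
  U := U
  nonempty := hU
  s := s
  bijective _ hV := ⟨coordinates_injective hs hV, coordinates_surjective hs hV⟩

theorem isBasisAt (a : SheafFrame M n) (hx : x ∈ a.U) : IsBasisAt a.s hx := by
  constructor
  · rw [Fintype.linearIndependent_iff]
    intro c hc
    obtain ⟨V, hV, hxV, r, hr⟩ := Scheme.exists_germ_eq_of_finite hx c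
    have h1 : M.germ V hxV (∑ i, r i • M.presheaf.map (homOfLE hV).op (a.s i)) =
        M.germ V hxV 0 := by
      rw [germ_sum_smul, map_zero, ← hc]
      simp only [hr]
    obtain ⟨W, hW, hxW, h2⟩ := exists_map_eq_of_germ_eq hxV h1
    rw [map_sum_smul, map_zero] at h2
    have h3 := (a.bijective W (hW.trans hV)).1 (a₁ := fun i ↦ X.presheaf.map (homOfLE hW).op (r i))
      (a₂ := 0) (h2.trans (by simp))
    intro i
    have h4 := congrArg (X.presheaf.germ W x hxW) (congrFun h3 i)
    rw [Pi.zero_apply, map_zero, TopCat.Presheaf.germ_res_apply] at h4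
    rw [← hr i]
    exact h4
  · rw [eq_top_iff]
    intro m _
    obtain ⟨V, hV, hxV, s, rfl⟩ := exists_le_germ_eq hx m
    obtain ⟨c, rfl⟩ := (a.bijective V hV).2 s
    simp only [germ_sum_smul]
    exact sum_mem fun i _ ↦ Submodule.smul_mem _ _ (Submodule.subset_span ⟨i, rfl⟩)

/-- The basis of the stalk given by a frame. -/
noncomputable def basisAt (a : SheafFrame M n) (hx : x ∈ a.U) :
    Module.Basis (Fin n) (X.presheaf.stalk x) (M.Stalk x) :=
  Module.Basis.mk (a.isBasisAt hx).1 (a.isBasisAt hx).2.ge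

theorem basisAt_apply (a : SheafFrame M n) (hx : x ∈ a.U) (i : Fin n) :
    a.basisAt hx i = M.germ a.U hx (a.s i) := by
  simp [basisAt]

theorem det_basisAt (a : SheafFrame M n) (hV : V ≤ a.U) (hx : x ∈ V)
    (P : Matrix (Fin n) (Fin n) Γ(X, V)) (s : Fin n → Γ(M, V))
    (h : ∀ i, ∑ j, P i j • M.presheaf.map (homOfLE hV).op (a.s j) = s i) :
    (a.basisAt (hV hx)).det (fun i ↦ M.germ V hx (s i)) = X.presheaf.germ V x hx P.det := by
  rw [Module.Basis.det_apply, ← Matrix.det_transpose P]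
  refine Eq.trans ?_ (RingHom.map_det (X.presheaf.germ V x hx).hom P.transpose).symm
  congr 1
  ext j i
  rw [Module.Basis.toMatrix_apply, ← h i, germ_sum_smul]
  simp only [← basisAt_apply, map_sum]
  simp [Finsupp.single_apply]

theorem exists_isBasisAt (a : SheafFrame M n) (hxa : x ∈ a.U) [Fintype ι] {s : ι → Γ(M, U)}
    (hx : x ∈ U) (hs : IsBasisAt s hx) :
    ∃ (W : X.Opens) (hW : W ≤ U), x ∈ W ∧ ∀ (y : X) (hy : y ∈ W), IsBasisAt s (hW hy) := by
  let e : ι ≃ Fin n := (Module.Basis.mk hs.1 hs.2.ge).indexEquiv (a.basisAt hxa)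
  choose P hP using fun i : Fin n ↦ (a.bijective (a.U ⊓ U) inf_le_left).2
    (M.presheaf.map (homOfLE inf_le_right).op (s (e.symm i)))
  have key : ∀ (y : X) (hy : y ∈ a.U ⊓ U), IsBasisAt s hy.2 ↔
      IsUnit (X.presheaf.germ (a.U ⊓ U) y hy (Matrix.det P)) := by
    intro y hy
    rw [← a.det_basisAt inf_le_left hy P _ hP, ← Module.Basis.is_basis_iff_det]
    simp only [germ_map, IsBasisAt]
    rw [← linearIndependent_equiv e.symm, ← e.symm.surjective.range_comp]
    rfl
  refine ⟨X.basicOpen (Matrix.det P), (X.basicOpen_le _).trans inf_le_right, ?_, ?_⟩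
  · rw [Scheme.mem_basicOpen X _ x (show x ∈ a.U ⊓ U from ⟨hxa, hx⟩)]
    exact (key x ⟨hxa, hx⟩).mp hs
  · intro y hy
    have hy' := X.basicOpen_le _ hy
    rw [Scheme.mem_basicOpen X _ y hy'] at hy
    exact (key y hy').mpr hy

end SheafFrame

namespace Module.Basis

variable {R M N P ι κ : Type*} [CommRing R] [AddCommGroup M] [Module R M] [AddCommGroup N]
  [Module R N] [AddCommGroup P] [Module R P]

theorem repr_eq_of_sum [Fintype ι] (b : Basis ι R M) (c : ι → R) {m : M}
    (h : ∑ i, c i • b i = m) (i : ι) : b.repr m i = c i := by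
  classical
  simp [← h, Finsupp.single_apply]

section Semilinear

variable {K W : Type*} [CommRing K] [AddCommGroup W] [Module K W] {σ : R →+* K}

theorem det_semilinearMap [Fintype ι] [DecidableEq ι] (b : Basis ι R M) (b' : Basis ι K W)
    (φ : M →ₛₗ[σ] W) (h : ∀ i, φ (b i) = b' i) (v : ι → M) :
    b'.det (fun i ↦ φ (v i)) = σ (b.det v) := by
  rw [det_apply, det_apply, RingHom.map_det]
  congr 1
  ext i j
  rw [toMatrix_apply, RingHom.mapMatrix_apply, Matrix.map_apply, toMatrix_apply]
  refine b'.repr_eq_of_sum (fun i ↦ σ (b.repr (v j) i)) ?_ i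
  conv_rhs => rw [← b.sum_repr (v j)]
  simp only [map_sum, LinearMap.map_smulₛₗ, h]

theorem semilinearMap_injective [Fintype ι] (hσ : Function.Injective σ) (b : Basis ι R M)
    (b' : Basis ι K W) (φ : M →ₛₗ[σ] W) (h : ∀ i, φ (b i) = b' i) : Function.Injective φ := by
  rw [injective_iff_map_eq_zero]
  intro m hm
  refine b.ext_elem fun i ↦ hσ ?_
  rw [← b.sum_repr m] at hm
  simp only [map_sum, LinearMap.map_smulₛₗ, h] at hm
  rw [← b'.repr_eq_of_sum _ hm i]
  simp

end Semilinear

theorem linearIndependent_semilinearMap {K W : Type*} [CommRing K] [IsDomain K]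
    [AddCommGroup W] [Module K W] [IsDomain R] [Algebra R K] [IsFractionRing R K] [Fintype ι]
    {φ : M →ₛₗ[algebraMap R K] W} (hφ : Function.Injective φ) {v : ι → M}
    (hv : LinearIndependent R v) : LinearIndependent K (fun i ↦ φ (v i)) := by
  rw [Fintype.linearIndependent_iff]
  intro c hc
  obtain ⟨b, hb⟩ := IsLocalization.exist_integer_multiples_of_finite (nonZeroDivisors R) c
  choose a ha using hb
  have h1 : φ (∑ i, a i • v i) = φ 0 := by
    simp only [map_sum, LinearMap.map_smulₛₗ, ha, Algebra.smul_def, mul_smul, map_zero]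
    rw [← Finset.smul_sum, hc, smul_zero]
  intro i
  have h2 := ha i
  rw [Fintype.linearIndependent_iff.mp hv a (hφ h1) i, map_zero, Algebra.smul_def] at h2
  exact (mul_eq_zero.mp h2.symm).resolve_left
    (IsFractionRing.to_map_ne_zero_of_mem_nonZeroDivisors b.2)

theorem linearIndependent_of_semilinearMap {K W : Type*} [CommRing K] [AddCommGroup W]
    [Module K W] {σ : R →+* K} (hσ : Function.Injective σ) [Fintype ι] {φ : M →ₛₗ[σ] W} {v : ι → M}
    (hv : LinearIndependent K (fun i ↦ φ (v i))) : LinearIndependent R v := by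
  rw [Fintype.linearIndependent_iff] at hv ⊢
  intro c hc i
  refine hσ ((hv (fun i ↦ σ (c i)) ?_ i).trans (map_zero σ).symm)
  rw [← map_zero φ, ← hc]
  simp only [map_sum, LinearMap.map_smulₛₗ]

theorem det_map_ne_zero [IsDomain R] [Fintype ι] [DecidableEq ι] (a : Basis ι R M)
    (b : Basis ι R N) {f : M →ₗ[R] N} (hf : Function.Injective f) :
    b.det (fun i ↦ f (a i)) ≠ 0 := by
  have : Module.Free R N := .of_basis b
  have : Module.Finite R N := .of_basis b
  have h := det_comp_basis a b f
  rw [Function.comp_def] at h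
  rw [h, Ne, LinearMap.det_eq_zero_iff_ker_ne_bot, not_not, LinearMap.ker_eq_bot]
  exact hf.comp (LinearEquiv.injective _)

section Exact

variable [Fintype ι] [Fintype κ] {f : M →ₗ[R] N} {g : N →ₗ[R] P}

theorem linearIndependent_sumElim (hf : Function.Injective f) (hfg : Function.Exact f g)
    {a : ι → M} (ha : LinearIndependent R a) {l : κ → N}
    (hl : LinearIndependent R fun j ↦ g (l j)) :
    LinearIndependent R (Sum.elim (fun i ↦ f (a i)) l) := by
  rw [Fintype.linearIndependent_iff] at ha hl ⊢
  intro w hw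
  simp only [Fintype.sum_sum_type, Sum.elim_inl, Sum.elim_inr] at hw
  have h1 : ∀ j, w (.inr j) = 0 := by
    refine hl _ ?_
    have := congrArg g hw
    simpa [hfg.apply_apply_eq_zero] using this
  simp only [h1, zero_smul, Finset.sum_const_zero, add_zero] at hw
  have h2 : ∀ i, w (.inl i) = 0 := by
    refine ha _ (hf ?_)
    simpa using hw
  rintro (i | j)
  exacts [h2 i, h1 j]

theorem span_sumElim (hfg : Function.Exact f g) {a : ι → M}
    (ha : Submodule.span R (Set.range a) = ⊤) {l : κ → N}
    (hl : Submodule.span R (Set.range fun j ↦ g (l j)) = ⊤) :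
    Submodule.span R (Set.range (Sum.elim (fun i ↦ f (a i)) l)) = ⊤ := by
  rw [eq_top_iff]
  intro n _
  obtain ⟨w, hw⟩ := (Submodule.mem_span_range_iff_exists_fun R).mp
    (hl ▸ Submodule.mem_top : g n ∈ Submodule.span R (Set.range fun j ↦ g (l j)))
  obtain ⟨m, hm⟩ := (hfg (n - ∑ j, w j • l j)).mp (by simp [← hw])
  obtain ⟨v, rfl⟩ := (Submodule.mem_span_range_iff_exists_fun R).mp
    (ha ▸ Submodule.mem_top : m ∈ Submodule.span R (Set.range a))
  refine (Submodule.mem_span_range_iff_exists_fun R).mpr ⟨Sum.elim v w, ?_⟩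
  rw [map_sum, eq_sub_iff_add_eq] at hm
  simpa using hm

theorem span_right_of_span_sumElim (hg : Function.Surjective g) (hfg : ∀ m, g (f m) = 0)
    {a : ι → M} {l : κ → N}
    (h : Submodule.span R (Set.range (Sum.elim (fun i ↦ f (a i)) l)) = ⊤) :
    Submodule.span R (Set.range fun j ↦ g (l j)) = ⊤ := by
  rw [eq_top_iff]
  intro m _
  obtain ⟨n, rfl⟩ := hg m
  obtain ⟨w, rfl⟩ := (Submodule.mem_span_range_iff_exists_fun R).mp
    (h ▸ Submodule.mem_top : n ∈ Submodule.span R (Set.range (Sum.elim (fun i ↦ f (a i)) l)))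
  exact (Submodule.mem_span_range_iff_exists_fun R).mpr ⟨fun j ↦ w (.inr j), by simp [hfg]⟩

theorem span_left_of_span_sumElim (hf : Function.Injective f) (hfg : ∀ m, g (f m) = 0)
    {a : ι → M} {l : κ → N} (hl : LinearIndependent R fun j ↦ g (l j))
    (h : Submodule.span R (Set.range (Sum.elim (fun i ↦ f (a i)) l)) = ⊤) :
    Submodule.span R (Set.range a) = ⊤ := by
  rw [eq_top_iff]
  intro m _
  obtain ⟨w, hw⟩ := (Submodule.mem_span_range_iff_exists_fun R).mp
    (h ▸ Submodule.mem_top : f m ∈ Submodule.span R (Set.range (Sum.elim (fun i ↦ f (a i)) l)))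
  simp only [Fintype.sum_sum_type, Sum.elim_inl, Sum.elim_inr] at hw
  have h1 : ∀ j, w (.inr j) = 0 := by
    refine Fintype.linearIndependent_iff.mp hl _ ?_
    have := congrArg g hw
    simpa [hfg] using this
  exact (Submodule.mem_span_range_iff_exists_fun R).mpr
    ⟨fun i ↦ w (.inl i), hf (by simpa [h1] using hw)⟩

theorem exists_of_injective [IsDomain R] [IsPrincipalIdealRing R] (b : Basis ι R N)
    (hf : Function.Injective f) : ∃ n, Nonempty (Basis (Fin n) R M) := by
  obtain ⟨n, ⟨c⟩⟩ := Submodule.nonempty_basis_of_pid b (LinearMap.range f)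
  exact ⟨n, ⟨c.map (LinearEquiv.ofInjective f hf).symm⟩⟩

theorem det_of_exact [DecidableEq ι] [DecidableEq κ] (hfg : ∀ m, g (f m) = 0)
    (a : Basis ι R M) (b : Basis (ι ⊕ κ) R N) (c : Basis κ R P)
    (hab : ∀ i, b (.inl i) = f (a i)) (hbc : ∀ j, g (b (.inr j)) = c j)
    {u : ι → M} {v : ι ⊕ κ → N} {w : κ → P}
    (huv : ∀ i, v (.inl i) = f (u i)) (hvw : ∀ j, g (v (.inr j)) = w j) :
    b.det v = a.det u * c.det w := by
  have h1 : ∀ m, f m = ∑ i, a.repr m i • b (.inl i) := fun m ↦ by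
    rw [← congrArg f (a.sum_repr m), map_sum]
    simp [hab]
  have h2 : ∀ m i, b.repr (f m) (.inl i) = a.repr m i := fun m i ↦
    b.repr_eq_of_sum (Sum.elim (a.repr m) 0) (by simp [h1 m]) (.inl i)
  have h3 : ∀ m j, b.repr (f m) (.inr j) = 0 := fun m j ↦
    b.repr_eq_of_sum (Sum.elim (a.repr m) 0) (by simp [h1 m]) (.inr j)
  have h4 : ∀ n j, c.repr (g n) j = b.repr n (.inr j) := fun n j ↦ by
    refine c.repr_eq_of_sum (fun j ↦ b.repr n (.inr j)) ?_ j
    rw [← congrArg g (b.sum_repr n), map_sum]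
    simp [hab, hbc, hfg]
  have h5 : b.toMatrix v = Matrix.fromBlocks (a.toMatrix u)
      (.of fun i j ↦ b.repr (v (.inr j)) (.inl i)) 0 (c.toMatrix w) := by
    ext (i | i) (j | j) <;> simp [toMatrix_apply, huv, h2, h3, ← hvw, h4]
  rw [det_apply, h5, Matrix.det_fromBlocks_zero₂₁]
  rfl

end Exact

end Module.Basis

namespace AlgebraicGeometry.Scheme.Modules

variable {X : Scheme.{u}} [IsIntegral X] {M N : X.Modules} {x : X} {ι : Type*}

/-- The map from a stalk to the stalk at the generic point. -/
noncomputable def toGeneric (M : X.Modules) (x : X) :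
    M.Stalk x →ₛₗ[algebraMap (X.presheaf.stalk x) X.functionField] M.Stalk (genericPoint X) where
  toFun := M.specialize (genericPoint_specializes x)
  map_add' := map_add _
  map_smul' := specialize_smul _

theorem stalkMap_toGeneric (φ : M ⟶ N) (m : M.Stalk x) :
    stalkMap φ _ (M.toGeneric x m) = N.toGeneric x (stalkMap φ x m) :=
  stalkMap_specialize φ _ m

theorem genericPoint_mem {U : X.Opens} (hx : x ∈ U) : genericPoint X ∈ U :=
  (genericPoint_specializes x).mem_open U.isOpen hx

theorem toGeneric_germ {U : X.Opens} (hx : x ∈ U) (s : Γ(M, U)) :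
    M.toGeneric x (M.germ U hx s) = M.germ U (genericPoint_mem hx) s :=
  specialize_germ _ hx s

end AlgebraicGeometry.Scheme.Modules

open Scheme.Modules

namespace SheafFrame

variable {X : Scheme.{u}} [IsIntegral X] {M N : X.Modules} {n : ℕ} {x : X} {ι : Type*}

theorem genericPoint_mem (a : SheafFrame M n) : genericPoint X ∈ a.U :=
  let ⟨y⟩ := a.nonempty
  Scheme.Modules.genericPoint_mem y.2

theorem toGeneric_basisAt (a : SheafFrame M n) (hx : x ∈ a.U) (i : Fin n) :
    M.toGeneric x (a.basisAt hx i) = a.basisAt a.genericPoint_mem i := by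
  rw [basisAt_apply, basisAt_apply, toGeneric_germ]

theorem toGeneric_injective (a : SheafFrame M n) (hx : x ∈ a.U) :
    Function.Injective (M.toGeneric x) :=
  (a.basisAt hx).semilinearMap_injective (IsFractionRing.injective _ _) _ _
    (a.toGeneric_basisAt hx)

theorem exists_basis_toGeneric [Fintype ι] (a : SheafFrame M n) (hx : x ∈ a.U)
    (b : Module.Basis ι (X.presheaf.stalk x) (M.Stalk x)) :
    ∃ b' : Module.Basis ι X.functionField (M.Stalk (genericPoint X)),
      ∀ i, M.toGeneric x (b i) = b' i := by
  classical
  let e := b.indexEquiv (a.basisAt hx)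
  let c := (a.basisAt hx).reindex e.symm
  let c' := (a.basisAt a.genericPoint_mem).reindex e.symm
  have h := c.det_semilinearMap c' (M.toGeneric x) (fun i ↦ by
    simp only [c, c', Module.Basis.reindex_apply, toGeneric_basisAt]) b
  have h1 := (c.isUnit_det b).map (algebraMap (X.presheaf.stalk x) X.functionField)
  rw [← h, ← Module.Basis.is_basis_iff_det] at h1
  exact ⟨.mk h1.1 h1.2.ge, fun i ↦ by simp⟩

theorem transitionDet_eq_det (a b : SheafFrame M n) :
    a.transitionDet b = (b.basisAt b.genericPoint_mem).det (a.basisAt a.genericPoint_mem) := by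
  have hη : genericPoint X ∈ a.U ⊓ b.U := ⟨a.genericPoint_mem, b.genericPoint_mem⟩
  have h := b.det_basisAt inf_le_right hη _ _ (a.sum_transitionMatrix b)
  simp only [germ_map] at h
  rw [transitionDet]
  refine h.symm.trans ?_
  congr 1
  funext i
  rw [basisAt_apply]

end SheafFrame

namespace AlgVectorBundle

section

variable {X : Scheme.{u}} [IsIntegral X] (V W : AlgVectorBundle X) {ι κ : Type*}

theorem rank_eq_card [Fintype ι]
    (b : Module.Basis ι X.functionField (V.sheaf.Stalk (genericPoint X))) :
    V.rank = Fintype.card ι := by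
  simpa using Fintype.card_congr
    (((V.frameAt (genericPoint X)).basisAt (V.mem_frameAt _)).indexEquiv b)

theorem toGeneric_injective (x : X) : Function.Injective (V.sheaf.toGeneric x) :=
  (V.frameAt x).toGeneric_injective (V.mem_frameAt x)

theorem linearIndependent_toGeneric [Fintype ι] {x : X} {v : ι → V.sheaf.Stalk x} :
    LinearIndependent X.functionField (fun i ↦ V.sheaf.toGeneric x (v i)) ↔
      LinearIndependent (X.presheaf.stalk x) v :=
  ⟨fun h ↦ Module.Basis.linearIndependent_of_semilinearMap (IsFractionRing.injective _ _) h,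
    fun h ↦ Module.Basis.linearIndependent_semilinearMap (V.toGeneric_injective x) h⟩

/-- The basis of the generic stalk given by a basis of a stalk. -/
noncomputable def genericBasis [Fintype ι] {x : X}
    (b : Module.Basis ι (X.presheaf.stalk x) (V.sheaf.Stalk x)) :
    Module.Basis ι X.functionField (V.sheaf.Stalk (genericPoint X)) :=
  ((V.frameAt x).exists_basis_toGeneric (V.mem_frameAt x) b).choose

theorem toGeneric_basis [Fintype ι] {x : X}
    (b : Module.Basis ι (X.presheaf.stalk x) (V.sheaf.Stalk x)) (i : ι) :
    V.sheaf.toGeneric x (b i) = V.genericBasis b i :=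
  ((V.frameAt x).exists_basis_toGeneric (V.mem_frameAt x) b).choose_spec i

theorem exists_algebraMap_eq_det [Fintype ι] [DecidableEq ι] {x : X}
    (b b' : Module.Basis ι (X.presheaf.stalk x) (V.sheaf.Stalk x)) :
    ∃ c, IsUnit c ∧ (V.genericBasis b).det (V.genericBasis b') =
      algebraMap (X.presheaf.stalk x) X.functionField c := by
  refine ⟨_, b.isUnit_det b', ?_⟩
  rw [← b.det_semilinearMap (V.genericBasis b) _ (V.toGeneric_basis b)]
  simp only [toGeneric_basis]

end

section Curve

open NonsingularProjectiveCurve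

variable {k : Type u} [Field k] {C : NonsingularProjectiveCurve k} (V W : AlgVectorBundle C.X)
  {ι κ : Type*}

theorem det_basis_ne_zero [Fintype ι] [DecidableEq ι]
    (b b' : Module.Basis ι C.X.functionField (V.sheaf.Stalk (genericPoint C.X))) :
    b.det b' ≠ 0 :=
  (b.isUnit_det b').ne_zero

theorem ord_det_genericBasis [Fintype ι] [DecidableEq ι] {x : C.X}
    (b b' : Module.Basis ι (C.X.presheaf.stalk x) (V.sheaf.Stalk x)) :
    Scheme.ord ((V.genericBasis b).det (V.genericBasis b')) x = 0 := by
  obtain ⟨c, hc, h⟩ := V.exists_algebraMap_eq_det b b'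
  rw [h, C.ord_algebraMap_of_isUnit hc]

/-- Up to a constant divisor, the divisor of `a` does not depend on the bases of the stalks. -/
theorem ord_det_eq [Fintype ι] [DecidableEq ι] {x : C.X}
    (b b' : Module.Basis ι (C.X.presheaf.stalk x) (V.sheaf.Stalk x))
    (a a' : Module.Basis ι C.X.functionField (V.sheaf.Stalk (genericPoint C.X))) :
    Scheme.ord ((V.genericBasis b).det a) x =
      Scheme.ord ((V.genericBasis b').det a') x + Scheme.ord (a'.det a) x := by
  rw [← (V.genericBasis b).det_mul_det (V.genericBasis b') a,
    ← (V.genericBasis b').det_mul_det a' a]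
  have h := V.det_basis_ne_zero (ι := ι)
  rw [Scheme.ord_mul (h _ _) (mul_ne_zero (h _ _) (h _ _)), Scheme.ord_mul (h _ _) (h _ _),
    V.ord_det_genericBasis, zero_add]

theorem finite_support_ord_det [Fintype ι] [DecidableEq ι]
    (b : ∀ x, Module.Basis ι (C.X.presheaf.stalk x) (V.sheaf.Stalk x))
    (a : Module.Basis ι C.X.functionField (V.sheaf.Stalk (genericPoint C.X))) :
    (Function.support fun x ↦ Scheme.ord ((V.genericBasis (b x)).det a) x).Finite := by
  let g := V.frameAt (genericPoint C.X)
  let e := (g.basisAt g.genericPoint_mem).indexEquiv a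
  let g' := (g.basisAt g.genericPoint_mem).reindex e
  have := g.nonempty
  refine ((C.finite_compl g.U).union (C.finite_support_ord
    (V.det_basis_ne_zero g' a))).subset fun x hx ↦ ?_
  by_contra h
  simp only [Set.mem_union, Set.mem_compl_iff, SetLike.mem_coe, not_or, not_not,
    Set.mem_ofPred_eq] at h
  refine hx ?_
  have h1 : V.genericBasis ((g.basisAt h.1).reindex e) = g' :=
    Module.Basis.eq_of_apply_eq fun i ↦ by
      rw [← toGeneric_basis]
      simp only [g', Module.Basis.reindex_apply, SheafFrame.toGeneric_basisAt]
  dsimp only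
  rw [V.ord_det_eq (b x) ((g.basisAt h.1).reindex e) a g', h1, h.2, Module.Basis.det_self, add_zero,
    ← map_one (algebraMap (C.X.presheaf.stalk x) C.X.functionField),
    C.ord_algebraMap_of_isUnit isUnit_one]

theorem degree_eq_finsum [IsAlgClosed k] [Fintype ι] [DecidableEq ι]
    (b : ∀ x, Module.Basis ι (C.X.presheaf.stalk x) (V.sheaf.Stalk x))
    (a : Module.Basis ι C.X.functionField (V.sheaf.Stalk (genericPoint C.X))) :
    V.degree = ∑ᶠ x, Scheme.ord ((V.genericBasis (b x)).det a) x := by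
  let g := V.frameAt (genericPoint C.X)
  let e := (g.basisAt g.genericPoint_mem).indexEquiv a
  let g' := (g.basisAt g.genericPoint_mem).reindex e
  let c := fun x ↦ ((V.frameAt x).basisAt (V.mem_frameAt x)).reindex e
  have h1 : ∀ x, V.genericBasis (c x) =
      ((V.frameAt x).basisAt (V.frameAt x).genericPoint_mem).reindex e := fun x ↦
    Module.Basis.eq_of_apply_eq fun i ↦ by
      rw [← toGeneric_basis]
      simp only [c, Module.Basis.reindex_apply, SheafFrame.toGeneric_basisAt]
  have h2 : ∀ x, V.detDivisor g x = Scheme.ord ((V.genericBasis (c x)).det g') x := fun x ↦ by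
    rw [detDivisor, SheafFrame.transitionDet_eq_det, h1, Module.Basis.det_reindex]
    congr 2
    funext i
    simp [g']
  simp only [V.ord_det_eq (b _) (c _) a g']
  rw [finsum_add_distrib (V.finite_support_ord_det c g')
    (C.finite_support_ord (V.det_basis_ne_zero g' a)),
    C.finsum_ord_eq_zero (V.det_basis_ne_zero g' a), add_zero]
  exact finsum_congr h2

end Curve

end AlgVectorBundle

open Scheme.Modules

namespace SheafFrame

variable {X : Scheme.{u}} {x : X} {U : X.Opens} {ι : Type*}

theorem exists_of_isBasisAt [Fintype ι] {M : X.Modules} {n : ℕ} {W : X.Opens} (hW : W ≤ U)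
    (hx : x ∈ W) (s : ι → Γ(M, U)) (hs : ∀ (y : X) (hy : y ∈ W), IsBasisAt s (hW hy))
    (hn : Fintype.card ι = n) : ∃ a : SheafFrame M n, x ∈ a.U := by
  let e := Fintype.equivFinOfCardEq hn
  refine ⟨ofIsBasisAt ⟨x, hx⟩ (fun i ↦ M.presheaf.map (homOfLE hW).op (s (e.symm i)))
    fun y hy ↦ ?_, hx⟩
  simp only [IsBasisAt, germ_map]
  refine ⟨(hs y hy).1.comp _ e.symm.injective, ?_⟩
  rw [← (hs y hy).2]
  congr 1
  exact e.symm.surjective.range_comp fun i ↦ M.germ U (hW hy) (s i)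

theorem exists_of_shortExact {S : ShortComplex X.Modules} (hS : S.ShortExact) {m n : ℕ}
    (a : SheafFrame S.X₁ m) (c : SheafFrame S.X₃ n) (hxa : x ∈ a.U) (hxc : x ∈ c.U) :
    ∃ b : SheafFrame S.X₂ (m + n), x ∈ b.U := by
  have := hS.epi_g
  have := hS.mono_f
  choose l hl using fun j ↦ stalkMap_surjective S.g x (c.basisAt hxc j)
  obtain ⟨V, hV, hxV, t, ht⟩ := Scheme.Modules.exists_germ_eq_of_finite
    (show x ∈ a.U ⊓ c.U from ⟨hxa, hxc⟩) l
  have h1 : ∀ j, S.X₃.germ V hxV (S.g.app V (t j)) =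
      S.X₃.germ V hxV (S.X₃.presheaf.map (homOfLE (hV.trans inf_le_right)).op (c.s j)) := fun j ↦ by
    rw [← stalkMap_germ, ht, hl, germ_map, basisAt_apply]
  choose W hWV hxW hW using fun j ↦ exists_map_eq_of_germ_eq hxV (h1 j)
  obtain ⟨W', hW'V, hxW', hW'⟩ := V.exists_le_forall_le hxV W hxW
  have h2 : ∀ (y : X) (hy : y ∈ W') (j), stalkMap S.g y (S.X₂.germ V (hW'V hy) (t j)) =
      S.X₃.germ c.U (hV (hW'V hy)).2 (c.s j) := fun y hy j ↦ by
    have h3 := congrArg (S.X₃.germ (W j) (hW' j hy)) (hW j)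
    rwa [germ_map, germ_map, germ_map, ← stalkMap_germ] at h3
  refine exists_of_isBasisAt (ι := Fin m ⊕ Fin n) le_rfl hxW' (Sum.elim
    (fun i ↦ S.X₂.presheaf.map (homOfLE (hW'V.trans (hV.trans inf_le_left))).op
      (S.f.app a.U (a.s i)))
    (fun j ↦ S.X₂.presheaf.map (homOfLE hW'V).op (t j))) (fun y hy ↦ ?_) (by simp)
  have h4 : (fun i ↦ S.X₂.germ W' hy (Sum.elim
      (fun i ↦ S.X₂.presheaf.map (homOfLE (hW'V.trans (hV.trans inf_le_left))).op
        (S.f.app a.U (a.s i)))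
      (fun j ↦ S.X₂.presheaf.map (homOfLE hW'V).op (t j)) i)) =
      Sum.elim (fun i ↦ stalkMap S.f y (S.X₁.germ a.U (hV (hW'V hy)).1 (a.s i)))
        (fun j ↦ S.X₂.germ V (hW'V hy) (t j)) := by
    funext i
    rcases i with i | j <;> simp [germ_map, stalkMap_germ]
  have ha := a.isBasisAt (hV (hW'V hy)).1
  have hc := c.isBasisAt (hV (hW'V hy)).2
  rw [IsBasisAt, h4]
  simp only [IsBasisAt, ← h2 y hy] at hc
  exact ⟨Module.Basis.linearIndependent_sumElim (stalkMap_injective S.f y) (stalkMap_exact hS y)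
      ha.1 hc.1, Module.Basis.span_sumElim (stalkMap_exact hS y) ha.2 hc.2⟩

end SheafFrame

namespace AlgVectorBundle

theorem exists_of_shortExact {X : Scheme.{u}} (E F : AlgVectorBundle X) {G : X.Modules}
    {i : E.sheaf ⟶ G} {p : G ⟶ F.sheaf} {w : i ≫ p = 0}
    (h : (ShortComplex.mk i p w).ShortExact) :
    ∃ V : AlgVectorBundle X, V.sheaf = G :=
  ⟨⟨G, E.rank + F.rank, fun x ↦ SheafFrame.exists_of_shortExact h _ _ (E.mem_frameAt x)
    (F.mem_frameAt x)⟩, rfl⟩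

variable {k : Type u} [Field k] {C : NonsingularProjectiveCurve k}

section

variable (E V F : AlgVectorBundle C.X) {i : E.sheaf ⟶ V.sheaf} {p : V.sheaf ⟶ F.sheaf}
  {w : i ≫ p = 0} (h : (ShortComplex.mk i p w).ShortExact)

include h

theorem exists_basis_of_shortExact {ι κ : Type*} [Fintype ι] [Fintype κ] {x : C.X}
    (a : Module.Basis ι (C.X.presheaf.stalk x) (E.sheaf.Stalk x))
    (c : Module.Basis κ (C.X.presheaf.stalk x) (F.sheaf.Stalk x)) :
    ∃ b : Module.Basis (ι ⊕ κ) (C.X.presheaf.stalk x) (V.sheaf.Stalk x),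
      (∀ j, b (.inl j) = stalkMap i x (a j)) ∧ ∀ j, stalkMap p x (b (.inr j)) = c j := by
  have : Epi p := h.epi_g
  have : Mono i := h.mono_f
  choose l hl using fun j ↦ stalkMap_surjective p x (c j)
  have hc := c.linearIndependent
  have hc' := c.span_eq
  rw [← funext hl] at hc hc'
  exact ⟨.mk (Module.Basis.linearIndependent_sumElim (stalkMap_injective i x) (stalkMap_exact h x)
    a.linearIndependent hc) (Module.Basis.span_sumElim (stalkMap_exact h x) a.span_eq hc').ge,
    by simp, by simpa using hl⟩

theorem rank_of_shortExact : V.rank = E.rank + F.rank := by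
  let e := E.frameAt (genericPoint C.X)
  let f := F.frameAt (genericPoint C.X)
  obtain ⟨b, -⟩ := exists_basis_of_shortExact E V F h (e.basisAt e.genericPoint_mem)
    (f.basisAt f.genericPoint_mem)
  simpa using V.rank_eq_card b

theorem degree_of_shortExact [IsAlgClosed k] : V.degree = E.degree + F.degree := by
  let e := fun x ↦ (E.frameAt x).basisAt (E.mem_frameAt x)
  let f := fun x ↦ (F.frameAt x).basisAt (F.mem_frameAt x)
  choose b hb hb' using fun x ↦ exists_basis_of_shortExact E V F h (e x) (f x)
  let η := genericPoint C.X
  rw [E.degree_eq_finsum e (e η), F.degree_eq_finsum f (f η), V.degree_eq_finsum b (b η),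
    ← finsum_add_distrib (E.finite_support_ord_det e (e η)) (F.finite_support_ord_det f (f η))]
  refine finsum_congr fun x ↦ ?_
  rw [← Scheme.ord_mul (E.det_basis_ne_zero _ _) (F.det_basis_ne_zero _ _)]
  congr 1
  refine Module.Basis.det_of_exact (f := stalkMap i η) (g := stalkMap p η)
    (fun m ↦ (stalkMap_exact h η).apply_apply_eq_zero m) _ _ _ (fun j ↦ ?_) (fun j ↦ ?_)
    (hb η) (hb' η)
  · rw [← toGeneric_basis, ← toGeneric_basis, hb, stalkMap_toGeneric]
  · rw [← toGeneric_basis, ← toGeneric_basis, ← hb', stalkMap_toGeneric]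

end

section Mono

variable (A B : AlgVectorBundle C.X) (φ : A.sheaf ⟶ B.sheaf) [Mono φ]

theorem exists_finsum_ord_det [IsAlgClosed k] (hr : A.rank = B.rank) :
    ∃ δ : ∀ x, C.X.presheaf.stalk x, (∀ x, δ x ≠ 0) ∧
      (∀ x, IsUnit (δ x) → Function.Surjective (stalkMap φ x)) ∧
      (Function.support fun x ↦
        Scheme.ord (algebraMap (C.X.presheaf.stalk x) C.X.functionField (δ x)) x).Finite ∧
      B.degree = (∑ᶠ x, Scheme.ord (algebraMap (C.X.presheaf.stalk x) C.X.functionField (δ x)) x) +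
        A.degree := by
  let η := genericPoint C.X
  let a := fun x ↦ (A.frameAt x).basisAt (A.mem_frameAt x)
  let b := fun x ↦ ((B.frameAt x).basisAt (B.mem_frameAt x)).reindex (finCongr hr.symm)
  let δ := fun x ↦ (b x).det fun i ↦ stalkMap φ x (a x i)
  have hδ : ∀ x, δ x ≠ 0 := fun x ↦ (a x).det_map_ne_zero (b x) (stalkMap_injective φ x)
  have hδ' : ∀ x, algebraMap (C.X.presheaf.stalk x) C.X.functionField (δ x) ≠ 0 := fun x h ↦
    hδ x ((map_eq_zero_iff _ (IsFractionRing.injective _ _)).mp h)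
  have h1 : ∀ x, ∃ d : Module.Basis _ C.X.functionField (B.sheaf.Stalk η),
      (∀ i, stalkMap φ η (A.genericBasis (a x) i) = d i) ∧ (B.genericBasis (b x)).det d =
        algebraMap (C.X.presheaf.stalk x) C.X.functionField (δ x) := fun x ↦ by
    have h2 : (B.genericBasis (b x)).det (fun i ↦ stalkMap φ η (A.genericBasis (a x) i)) =
        algebraMap (C.X.presheaf.stalk x) C.X.functionField (δ x) := by
      rw [← (b x).det_semilinearMap _ _ (B.toGeneric_basis (b x))]
      simp only [← toGeneric_basis]
      exact congrArg _ (funext fun i ↦ stalkMap_toGeneric φ _)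
    have h3 := (hδ' x).isUnit
    rw [← h2, ← Module.Basis.is_basis_iff_det] at h3
    exact ⟨.mk h3.1 h3.2.ge, by simp, by simpa using h2⟩
  choose d hd hd' using h1
  have h4 : ∀ x, Scheme.ord ((B.genericBasis (b x)).det (d η)) x =
      Scheme.ord (algebraMap (C.X.presheaf.stalk x) C.X.functionField (δ x)) x +
        Scheme.ord ((A.genericBasis (a x)).det (A.genericBasis (a η))) x := fun x ↦ by
    rw [← (B.genericBasis (b x)).det_mul_det (d x), hd', Scheme.ord_mul (hδ' x)
      (B.det_basis_ne_zero _ _), ← funext (hd η)]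
    congr 2
    exact (A.genericBasis (a x)).det_semilinearMap (d x) (stalkMap φ η) (hd x) _
  have h5 := A.finite_support_ord_det a (A.genericBasis (a η))
  have h6 : (Function.support fun x ↦
      Scheme.ord (algebraMap (C.X.presheaf.stalk x) C.X.functionField (δ x)) x).Finite := by
    refine ((B.finite_support_ord_det b (d η)).union h5).subset fun x hx ↦ ?_
    by_contra h
    simp only [Set.mem_union, Function.mem_support, not_or, not_not] at h
    rw [h4, h.2, add_zero] at h
    exact hx h.1
  refine ⟨δ, hδ, fun x hx ↦ ?_, h6, ?_⟩
  · have h7 := ((b x).is_basis_iff_det.mpr hx).2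
    rw [← LinearMap.range_eq_top, eq_top_iff, ← h7, Submodule.span_le]
    rintro _ ⟨i, rfl⟩
    exact ⟨_, rfl⟩
  · rw [B.degree_eq_finsum b (d η), A.degree_eq_finsum a (A.genericBasis (a η)),
      ← finsum_add_distrib h6 h5]
    exact finsum_congr h4

theorem degree_le_of_mono (A B : AlgVectorBundle C.X) (φ : A.sheaf ⟶ B.sheaf) [Mono φ]
    [IsAlgClosed k] (hr : A.rank = B.rank) : A.degree ≤ B.degree := by
  obtain ⟨δ, -, -, -, h⟩ := exists_finsum_ord_det A B φ hr
  rw [h]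
  exact le_add_of_nonneg_left (finsum_nonneg fun x ↦ C.ord_algebraMap_nonneg)

theorem isIso_of_degree_eq [IsAlgClosed k] (hr : A.rank = B.rank) (hd : A.degree = B.degree) :
    IsIso φ := by
  obtain ⟨δ, hδ, hδ', hfin, h⟩ := exists_finsum_ord_det A B φ hr
  refine isIso_of_stalkMap_bijective φ fun x ↦ ⟨stalkMap_injective φ x, hδ' x ?_⟩
  have h1 : ∀ x, Scheme.ord (algebraMap (C.X.presheaf.stalk x) C.X.functionField (δ x)) x = 0 := by
    by_contra! h2
    obtain ⟨y, hy⟩ := h2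
    have h3 := finsum_pos (fun x ↦ C.ord_algebraMap_nonneg (a := δ x))
      ⟨y, lt_of_le_of_ne C.ord_algebraMap_nonneg hy.symm⟩ hfin
    omega
  by_cases hx : Order.coheight x = 1
  · exact (C.ord_algebraMap_eq_zero_iff hx (hδ x)).mp (h1 x)
  · rw [C.coheight_eq_one_iff, not_not] at hx
    subst hx
    exact (hδ _).isUnit

end Mono

end AlgVectorBundle

open Scheme.Modules

namespace AlgVectorBundle

variable {k : Type u} [Field k] {C : NonsingularProjectiveCurve k}

section Image

variable (V F : AlgVectorBundle C.X) {N Q : C.X.Modules} {f : N ⟶ V.sheaf} {g : V.sheaf ⟶ Q}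
  {w : f ≫ g = 0} (h : (ShortComplex.mk f g w).ShortExact) (j : Q ⟶ F.sheaf) [Mono j]

include h j

theorem exists_isBasisAt_of_shortExact (x : C.X) :
    ∃ (m n : ℕ) (U W : C.X.Opens) (hW : W ≤ U) (s : Fin m → Γ(N, U)) (t : Fin n → Γ(Q, U)),
      x ∈ W ∧ ∀ (y : C.X) (hy : y ∈ W), IsBasisAt s (hW hy) ∧ IsBasisAt t (hW hy) := by
  have : Epi g := h.epi_g
  have : Mono f := h.mono_f
  have hzero : ∀ y m, stalkMap g y (stalkMap f y m) = 0 := fun y m ↦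
    (stalkMap_exact h y).apply_apply_eq_zero m
  obtain ⟨m, ⟨a⟩⟩ := ((V.frameAt x).basisAt (V.mem_frameAt x)).exists_of_injective
    (stalkMap_injective f x)
  obtain ⟨n, ⟨c⟩⟩ := ((F.frameAt x).basisAt (F.mem_frameAt x)).exists_of_injective
    (stalkMap_injective j x)
  choose l hl using fun i ↦ stalkMap_surjective g x (c i)
  obtain ⟨U', -, hxU', s, hs⟩ := Scheme.Modules.exists_germ_eq_of_finite
    (Opens.mem_top x) a
  obtain ⟨U, hUU', hxU, t, ht⟩ := Scheme.Modules.exists_germ_eq_of_finite hxU' l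
  have hlc : LinearIndependent (C.X.presheaf.stalk x) fun i ↦ stalkMap g x (l i) := by
    rw [funext hl]; exact c.linearIndependent
  let s' := fun i ↦ N.presheaf.map (homOfLE hUU').op (s i)
  let σ : Fin m ⊕ Fin n → Γ(V.sheaf, U) := Sum.elim (fun i ↦ f.app U (s' i)) t
  have hσ : ∀ (y : C.X) (hy : y ∈ U), (fun i ↦ V.sheaf.germ U hy (σ i)) =
      Sum.elim (fun i ↦ stalkMap f y (N.germ U hy (s' i))) fun i ↦ V.sheaf.germ U hy (t i) := by
    intro y hy
    funext i
    rcases i with i | i <;> simp [σ, stalkMap_germ]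
  have hx : IsBasisAt σ hxU := by
    rw [IsBasisAt, hσ]
    simp only [s', germ_map, hs, ht]
    refine ⟨Module.Basis.linearIndependent_sumElim (stalkMap_injective f x) (stalkMap_exact h x)
      a.linearIndependent hlc, Module.Basis.span_sumElim (stalkMap_exact h x) a.span_eq ?_⟩
    exact (congrArg _ (congrArg Set.range (funext hl))).trans c.span_eq
  have hgen : LinearIndependent C.X.functionField fun i ↦
      F.sheaf.germ U (genericPoint_mem hxU) (j.app U (g.app U (t i))) := by
    have h1 := F.linearIndependent_toGeneric.mpr
      (hlc.map' (stalkMap j x) (LinearMap.ker_eq_bot.mpr (stalkMap_injective j x)))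
    simpa only [Function.comp_apply, ← ht, stalkMap_germ, toGeneric_germ] using h1
  obtain ⟨W, hW, hxW, hb⟩ := (V.frameAt x).exists_isBasisAt (V.mem_frameAt x) hxU hx
  refine ⟨m, n, U, W, hW, s', fun i ↦ g.app U (t i), hxW, fun y hy ↦ ?_⟩
  have h1 := hb y hy
  rw [IsBasisAt, hσ] at h1
  have h2 : LinearIndependent (C.X.presheaf.stalk y) fun i ↦
      stalkMap g y (V.sheaf.germ U (hW hy) (t i)) := by
    refine LinearIndependent.of_comp (stalkMap j y) (F.linearIndependent_toGeneric.mp ?_)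
    simpa only [Function.comp_apply, stalkMap_germ, toGeneric_germ] using hgen
  have h3 : LinearIndependent (C.X.presheaf.stalk y) fun i ↦ N.germ U (hW hy) (s' i) :=
    LinearIndependent.of_comp (stalkMap f y) (h1.1.comp Sum.inl Sum.inl_injective)
  have h4 := Module.Basis.span_left_of_span_sumElim (stalkMap_injective f y) (hzero y) h2 h1.2
  have h5 := Module.Basis.span_right_of_span_sumElim (stalkMap_surjective g y) (hzero y) h1.2
  refine ⟨⟨h3, h4⟩, ?_⟩
  simp only [IsBasisAt, ← stalkMap_germ]
  exact ⟨h2, h5⟩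

theorem exists_sheaf_eq_of_shortExact :
    (∃ A : AlgVectorBundle C.X, A.sheaf = N) ∧ ∃ B : AlgVectorBundle C.X, B.sheaf = Q := by
  choose m n U W hW s t hx hb using exists_isBasisAt_of_shortExact V F h j
  let η := genericPoint C.X
  have hη : ∀ x, η ∈ W x := fun x ↦ genericPoint_mem (hx x)
  refine ⟨⟨⟨N, Module.finrank C.X.functionField (N.Stalk η), fun x ↦ ?_⟩, rfl⟩,
    ⟨⟨Q, Module.finrank C.X.functionField (Q.Stalk η), fun x ↦ ?_⟩, rfl⟩⟩
  · have h1 := (hb x η (hη x)).1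
    exact SheafFrame.exists_of_isBasisAt (hW x) (hx x) (s x) (fun y hy ↦ (hb x y hy).1)
      (Module.finrank_eq_card_basis (Module.Basis.mk h1.1 h1.2.ge)).symm
  · have h1 := (hb x η (hη x)).2
    exact SheafFrame.exists_of_isBasisAt (hW x) (hx x) (t x) (fun y hy ↦ (hb x y hy).2)
      (Module.finrank_eq_card_basis (Module.Basis.mk h1.1 h1.2.ge)).symm

end Image

theorem rank_le_of_mono (A B : AlgVectorBundle C.X) (φ : A.sheaf ⟶ B.sheaf) [Mono φ] :
    A.rank ≤ B.rank := by
  let η := genericPoint C.X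
  let a := (A.frameAt η).basisAt (A.mem_frameAt η)
  let b := (B.frameAt η).basisAt (B.mem_frameAt η)
  have h := a.linearIndependent.map' (stalkMap φ η)
    (LinearMap.ker_eq_bot.mpr (stalkMap_injective φ η))
  have : Module.Finite C.X.functionField (B.sheaf.Stalk η) := .of_basis b
  simpa [Module.finrank_eq_card_basis b] using h.fintype_card_le_finrank

theorem subsingleton_stalk (A : AlgVectorBundle C.X) (hA : A.rank = 0) (x : C.X) :
    Subsingleton (A.sheaf.Stalk x) := by
  have : IsEmpty (Fin A.rank) := hA ▸ Fin.isEmpty'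
  exact ((A.frameAt x).basisAt (A.mem_frameAt x)).repr.toEquiv.subsingleton

variable [IsAlgClosed k]

theorem degree_eq_zero_of_rank_eq_zero (A : AlgVectorBundle C.X) (hA : A.rank = 0) :
    A.degree = 0 := by
  let a := fun x ↦ (A.frameAt x).basisAt (A.mem_frameAt x)
  have : IsEmpty (Fin A.rank) := hA ▸ Fin.isEmpty'
  rw [A.degree_eq_finsum a (a (genericPoint C.X))]
  refine finsum_eq_zero_of_forall_eq_zero fun x ↦ ?_
  rw [Module.Basis.det_isEmpty, AlternatingMap.constOfIsEmpty_apply, Function.const_apply,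
    ← map_one (algebraMap (C.X.presheaf.stalk x) C.X.functionField),
    C.ord_algebraMap_of_isUnit isUnit_one]

/-- The slope inequality for an arbitrary locally free subsheaf of a stable bundle. -/
theorem IsStable.cases_of_mono {E : AlgVectorBundle C.X} (hE : E.IsStable)
    (A : AlgVectorBundle C.X) (φ : A.sheaf ⟶ E.sheaf) [Mono φ] :
    (A.rank = 0 ∧ A.degree = 0) ∨ (A.rank = E.rank ∧ A.degree ≤ E.degree) ∨
      (A.rank < E.rank ∧ A.degree * E.rank < A.rank * E.degree) := by
  rcases Nat.eq_zero_or_pos A.rank with h0 | h0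
  · exact .inl ⟨h0, A.degree_eq_zero_of_rank_eq_zero h0⟩
  rcases (rank_le_of_mono A E φ).eq_or_lt with h1 | h1
  · exact .inr (.inl ⟨h1, degree_le_of_mono A E φ h1⟩)
  · have h2 := hE.2 A φ inferInstance h0 h1
    rw [slope, slope, div_lt_div_iff₀ (by exact_mod_cast h0) (by exact_mod_cast hE.1)] at h2
    refine .inr (.inr ⟨h1, ?_⟩)
    rw [mul_comm (A.rank : ℤ)]
    exact_mod_cast h2

theorem slope_arith {s t e f a b x y : ℤ} (hef : f * s - t * e = 1) (hs : 0 < s) (ht : 0 < t)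
    (ha : 0 ≤ a) (hb : 0 ≤ b) (h0 : 0 < a + b) (hlt : a + b < s + t)
    (hA : (a = 0 ∧ x = 0) ∨ (a = s ∧ x ≤ e) ∨ (a < s ∧ x * s < a * e))
    (hB : (b = 0 ∧ y = 0) ∨ (b = t ∧ y ≤ f) ∨ (b < t ∧ y * t < b * f))
    (hsplit : b = t → y = f → a ≠ 0) :
    (x + y) * (s + t) < (a + b) * (e + f) := by
  have hA' : 0 ≤ a * (e + f) - x * (s + t) ∧ (0 < a → 0 < a * (e + f) - x * (s + t)) ∧
      (0 < a → a < s → 1 < a * (e + f) - x * (s + t)) := by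
    have h1 : s * (a * (e + f) - x * (s + t)) = (s + t) * (a * e - x * s) + a := by
      linear_combination a * hef
    rcases hA with ⟨rfl, rfl⟩ | ⟨rfl, hx⟩ | ⟨h, hx⟩
    · simp
    · have h2 : 0 ≤ (a + t) * (a * e - x * a) :=
        mul_nonneg (by omega) (by nlinarith)
      have h3 : 0 < a * (a * (e + f) - x * (a + t)) := by rw [h1]; omega
      have h4 := (mul_pos_iff_of_pos_left hs).mp h3
      exact ⟨h4.le, fun _ ↦ h4, fun _ h ↦ absurd h (lt_irrefl _)⟩
    · have h2 : s + t ≤ (s + t) * (a * e - x * s) := le_mul_of_one_le_right (by omega) (by omega)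
      have h3 : s * 1 < s * (a * (e + f) - x * (s + t)) := by rw [h1]; omega
      have h4 := lt_of_mul_lt_mul_left h3 hs.le
      exact ⟨by omega, fun _ ↦ by omega, fun _ _ ↦ h4⟩
  have hB' : (b = 0 ∧ 0 ≤ b * (e + f) - y * (s + t)) ∨ 0 < b * (e + f) - y * (s + t) ∨
      (b = t ∧ y = f ∧ b * (e + f) - y * (s + t) = -1) := by
    have h1 : t * (b * (e + f) - y * (s + t)) = (s + t) * (b * f - y * t) - b := by
      linear_combination (-b) * hef
    rcases hB with ⟨rfl, rfl⟩ | ⟨rfl, hy⟩ | ⟨h, hy⟩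
    · simp
    · rcases hy.eq_or_lt with rfl | hy
      · exact .inr (.inr ⟨rfl, rfl, by linear_combination -hef⟩)
      · have h2 : s + b ≤ (s + b) * (b * f - y * b) :=
          le_mul_of_one_le_right (by omega) (by nlinarith)
        have h3 : 0 < b * (b * (e + f) - y * (s + b)) := by rw [h1]; omega
        exact .inr (.inl ((mul_pos_iff_of_pos_left ht).mp h3))
    · have h2 : s + t ≤ (s + t) * (b * f - y * t) := le_mul_of_one_le_right (by omega) (by omega)
      have h3 : 0 < t * (b * (e + f) - y * (s + t)) := by rw [h1]; omega
      exact .inr (.inl ((mul_pos_iff_of_pos_left ht).mp h3))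
  have key : 0 < (a * (e + f) - x * (s + t)) + (b * (e + f) - y * (s + t)) := by
    obtain ⟨h1, h2, h3⟩ := hA'
    rcases hB' with ⟨h4, h5⟩ | h4 | ⟨h4, h5, h6⟩
    · have := h2 (by omega)
      omega
    · omega
    · have h7 := hsplit h4 h5
      have := h3 (by omega) (by omega)
      omega
  linarith

section Extension

variable {E F V : AlgVectorBundle C.X} {i : E.sheaf ⟶ V.sheaf} {p : V.sheaf ⟶ F.sheaf}
  {w : i ≫ p = 0} (h : (ShortComplex.mk i p w).ShortExact)
  (hns : ¬ Nonempty (ShortComplex.mk i p w).Splitting)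

include h hns

theorem rank_ne_zero_of_not_splitting {A B W : AlgVectorBundle C.X} {n : A.sheaf ⟶ W.sheaf}
    {q : W.sheaf ⟶ B.sheaf} {w' : n ≫ q = 0} (h' : (ShortComplex.mk n q w').ShortExact)
    (j : W.sheaf ⟶ V.sheaf) (β : B.sheaf ⟶ F.sheaf) [Mono β] (hβ : q ≫ β = j ≫ p)
    (hr : B.rank = F.rank) (hd : B.degree = F.degree) : A.rank ≠ 0 := by
  intro hA
  have : Epi q := h'.epi_g
  have h1 : IsIso β := isIso_of_degree_eq B F β hr hd
  have h2 : IsIso q := isIso_of_stalkMap_bijective q fun x ↦ by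
    refine ⟨?_, stalkMap_surjective q x⟩
    rw [injective_iff_map_eq_zero]
    intro m hm
    obtain ⟨l, rfl⟩ := (stalkMap_exact h' x m).mp hm
    have := A.subsingleton_stalk hA x
    rw [Subsingleton.elim l 0, map_zero]
  exact hns ⟨.ofExactOfSection _ h.exact (inv β ≫ inv q ≫ j) (by simp [← hβ]) h.mono_f⟩

theorem degree_mul_lt_of_not_splitting (hE : E.IsStable) (hF : F.IsStable)
    (hef : F.degree * E.rank - F.rank * E.degree = 1)
    {A B W : AlgVectorBundle C.X} {n : A.sheaf ⟶ W.sheaf}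
    {q : W.sheaf ⟶ B.sheaf} {w' : n ≫ q = 0} (h' : (ShortComplex.mk n q w').ShortExact)
    (j : W.sheaf ⟶ V.sheaf) (α : A.sheaf ⟶ E.sheaf) [Mono α] (β : B.sheaf ⟶ F.sheaf) [Mono β]
    (hβ : q ≫ β = j ≫ p) (h0 : 0 < W.rank) (hW : W.rank < V.rank) :
    W.degree * V.rank < W.rank * V.degree := by
  have hsplit : B.rank = F.rank → B.degree = F.degree → A.rank ≠ 0 :=
    rank_ne_zero_of_not_splitting h hns h' j β hβ
  have h1 := rank_of_shortExact _ _ _ h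
  have h2 := rank_of_shortExact _ _ _ h'
  rw [degree_of_shortExact _ _ _ h, degree_of_shortExact _ _ _ h', h1, h2]
  rw [h1, h2] at hW
  rw [h2] at h0
  push_cast
  refine slope_arith hef (mod_cast hE.1) (mod_cast hF.1) (by positivity) (by positivity)
    (mod_cast h0) (mod_cast hW) ?_ ?_ ?_
  · rcases hE.cases_of_mono A α with ⟨h3, h4⟩ | ⟨h3, h4⟩ | ⟨h3, h4⟩
    · exact .inl ⟨mod_cast h3, h4⟩
    · exact .inr (.inl ⟨mod_cast h3, h4⟩)
    · exact .inr (.inr ⟨mod_cast h3, h4⟩)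
  · rcases hF.cases_of_mono B β with ⟨h3, h4⟩ | ⟨h3, h4⟩ | ⟨h3, h4⟩
    · exact .inl ⟨mod_cast h3, h4⟩
    · exact .inr (.inl ⟨mod_cast h3, h4⟩)
    · exact .inr (.inr ⟨mod_cast h3, h4⟩)
  · exact fun h3 h4 ↦ mod_cast hsplit (mod_cast h3) h4

theorem isStable_of_not_splitting (hE : E.IsStable) (hF : F.IsStable)
    (hef : F.degree * E.rank - F.rank * E.degree = 1) : V.IsStable := by
  have h0 : 0 < V.rank := by
    rw [rank_of_shortExact _ _ _ h]
    exact Nat.add_pos_left hE.1 _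
  refine ⟨h0, fun W j hj hW0 hW ↦ ?_⟩
  obtain ⟨N, n, hn, Q, q, β, hq, hβ, w', h', hfac⟩ : ∃ (N : C.X.Modules) (n : N ⟶ W.sheaf)
      (_ : n ≫ j ≫ p = 0) (Q : C.X.Modules) (q : W.sheaf ⟶ Q) (β : Q ⟶ F.sheaf) (_ : Epi q)
      (_ : Mono β) (w' : n ≫ q = 0), (ShortComplex.mk n q w').ShortExact ∧ q ≫ β = j ≫ p := by
    refine ⟨Limits.kernel (j ≫ p), Limits.kernel.ι _, Limits.kernel.condition _,
      Abelian.image (j ≫ p), Abelian.factorThruImage _, Abelian.image.ι _, inferInstance,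
      inferInstance, ?_, ?_, Abelian.image.fac _⟩
    · rw [← cancel_mono (Abelian.image.ι (j ≫ p)), Category.assoc, Abelian.image.fac,
        Limits.kernel.condition, Limits.zero_comp]
    · refine .mk' (ShortComplex.exact_of_f_is_kernel _ ?_) inferInstance inferInstance
      exact Limits.isKernelOfComp _ _ (Limits.kernelIsKernel (j ≫ p)) _ (Abelian.image.fac _)
  obtain ⟨⟨A, rfl⟩, ⟨B, rfl⟩⟩ := exists_sheaf_eq_of_shortExact W F h' β
  have hi : Mono i := h.mono_f
  have hn' : Mono n := h'.mono_f
  let α : A.sheaf ⟶ E.sheaf := h.exact.lift (n ≫ j) (by simpa using hn)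
  have hα : α ≫ i = n ≫ j := h.exact.lift_f _ _
  have : Mono (α ≫ i) := hα ▸ mono_comp n j
  have : Mono α := mono_of_mono α i
  have key := degree_mul_lt_of_not_splitting h hns hE hF hef h' j α β hfac hW0 hW
  rw [slope, slope, div_lt_div_iff₀ (mod_cast hW0) (mod_cast h0), mul_comm (V.degree : ℚ)]
  exact_mod_cast key

end Extension

end AlgVectorBundle

theorem mainTheorem5 {k : Type u} [Field k] [IsAlgClosed k] (C : NonsingularProjectiveCurve k)
    (r s t : ℕ) (d e f : ℤ) (hr : r = s + t) (hd : d = e + f)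
    (hde : d * (s : ℤ) - (r : ℤ) * e = 1)
    (E F : AlgVectorBundle C.X)
    (hE : E.IsStable) (hEs : E.rank = s) (hEe : E.degree = e)
    (hF : F.IsStable) (hFt : F.rank = t) (hFf : F.degree = f)
    (G : C.X.Modules) (i : E.sheaf ⟶ G) (p : G ⟶ F.sheaf) (w : i ≫ p = 0)
    (hexact : (ShortComplex.mk i p w).ShortExact)
    (hnontrivial : ¬ Nonempty (ShortComplex.mk i p w).Splitting) :
    ∃ V : AlgVectorBundle C.X,
      V.sheaf = G ∧ V.rank = r ∧ V.degree = d ∧ V.IsStable := by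
  subst hEs hEe hFt hFf hr hd
  obtain ⟨V, rfl⟩ := AlgVectorBundle.exists_of_shortExact E F hexact
  refine ⟨V, rfl, E.rank_of_shortExact V F hexact, E.degree_of_shortExact V F hexact,
    AlgVectorBundle.isStable_of_not_splitting hexact hnontrivial hE hF ?_⟩
  push_cast at hde
  linear_combination hde
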